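/- **Setting.** On a probability space $(\Omega,\mathcal F,P)$ let $X_{k+1}=f(X_k,U_k,\xi_k)$, $Y_k=h(X_k,\eta_k)$, $U_k=\pi_k(I_k)\in\mathcal U$, where $X_k\in\mathbb R^{n_x}$, $U_k\in\mathbb R^{n_u}$, $Y_k\in\mathbb R^{n_y}$, $I_k=(Y_0,U_0,\dots,Y_{k-1},U_{k-1},Y_k)$, the maps $f,h,\pi_k$ are measurable, $(\xi_k)$ and $(\eta_k)$ are i.i.d. sequences, and $X_0,(\xi_k)_k,(\eta_k)_k$ are independent. Assume that $f(x,u,\xi_0)$ has the Lebesgue density $z\mapsto K(z,x,u)$ for all $x,u$, and that $h(x,\eta_0)$ has the Lebesgue density $y\mapsto\rho(y,x)$ for all $x$, with $K,\rho$ measurable and $[0,\infty]$-valued. "For a.a. $i_k$" refers to the law of $I_k$. Let $\mu_k$ be the conditional law of $X_k$ given $I_k=i_k$ and, for $k\ge1$, $\mu_{k|k-1}$ the conditional law of $X_k$ given $I_{k-1}=i_{k-1}$, where $i_{k-1}$ is the corresponding part of $i_k$; write $\langle\mu_{k|k-1},\rho\rangle=\int\rho(y_k,x)\,\mu_{k|k-1}(dx)$,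 $\langle\mu_k,\rho\rangle=\int\rho(y_k,x)\,\mu_k(dx)$ and $\gamma_k=\operatorname{ess\,inf}_{i_k}\langle\mu_{k|k-1},\rho\rangle$. Let $\phi_j(x)=x_j$ and, for given $i_k$, let $\|K\|=\sup_{x_1,x_0}K(x_1,x_0,u_{k-1})$, $\|\rho\|=\sup_x\rho(y_k,x)$, $\|\rho\phi_j^m\|=\sup_x|x_j|^m\rho(y_k,x)$, and $\|\phi_j\|_{k,2}=\max(1,\langle\mu_0,\phi_j^2\rangle^{1/2},\dots,\langle\mu_k,\phi_j^2\rangle^{1/2})$. **Particle filter.** For every $N$ and every step let a doubly stochastic $N\times N$ matrix $(a_{il})$ be given (for instance the identity). Given $i_k$, the filter draws $x_0^1,\dots,x_0^N$ i.i.d. from $\mu_0$. For $k\ge1$ it draws independent predicted particles $\bar x_k^i$ with laws $\sum_l a_{il}K(z,x_{k-1}^l,u_{k-1})\,dz$ (their empirical measure is $\mu^N_{k|k-1}$), repeats this draw from the same $x_{k-1}^{1:N}$ until $\frac1N\sum_i\rho(y_k,\bar x_k^i)\ge\gamma_k/2$, and then draws $x_k^1,\dots,x_k^N$ i.i.d.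 from the accepted particles with weights proportional to $\rho(y_k,\cdot)$. All probabilities and expectations over the particles at time $k$ are conditional on the termination of the selection steps performed up to that moment. Given $I_k=i_k$ the particles are independent of $X_k$. Put $\widehat X_k^N=\frac1N\sum_i x_k^i$, $\widehat X_k^*=\int x\,\mu_k(dx)$ and, with values in $[0,\infty]$, $$e^{cond}_{k,*}(i_k)=E[\|X_k-\widehat X_k^*\|^2\mid I_k=i_k],\qquad e^{cond}_{k,N}(i_k)=E[\|X_k-\widehat X_k^N\|^2\mid I_k=i_k].$$ **Assumptions.** Let $0<\epsilon_k<1$ ($k\ge1$) and integers $N_k(i_k)\ge1$ ($k\ge 0$) be such that for every $k\ge1$: 1. $\gamma_k>0$ and, for a.a. $i_k$ and all $N\ge N_k(i_k)$, $P(\langle\mu^N_{k|k-1},\rho\rangle>\gamma_k\mid I_k=i_k)\ge1-\epsilon_k$; 2. $\rho(Y_k,X_k)<\infty$ and $K(X_k,X_{k-1},U_{k-1})<\infty$ almost surely; 3. for a.a. $i_k$, $\|K\|<\infty$, $\|\rho\|<\infty$ and $\|\rho\phi_j^2\|<\infty$ for $j=1,\dots,n_x$. **Theorem.** For every $k\ge0$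 and a.a. $i_k$ there are constants $C_{k,j}>0$ ($j=1,\dots,n_x$), depending on $i_k$ but neither on $N$ nor on $\epsilon$, such that for all $\epsilon>0$ and all $N\ge N_k(i_k)$ $$e^{cond}_{k,*}(i_k)\le e^{cond}_{k,N}(i_k)\le(1+\epsilon)\,e^{cond}_{k,*}(i_k)+\Big(1+\frac1\epsilon\Big)\frac{\sum_{j=1}^{n_x}C_{k,j}\|\phi_j\|_{k,2}^2}{N}.$$ Moreover they can be taken of the following form, for some $\widetilde C>0$ (depending on $k$ and $i_k$): $M_{0,j}=3$, $C_{0,j}=8\widetilde C$ and, at each step $1\le s\le k$, evaluated at the corresponding part $i_s$ of $i_k$, $$M_{s,j}=2+\alpha_{s,j}\Big(1+\Big(\frac{4-\epsilon_s}{1-\epsilon_s}+1\Big)M_{s-1,j}\Big),$$ $$C_{s,j}^{1/2}=2^{3/2}\widetilde C^{1/2}M_{s,j}^{1/2}+\frac{2^{3/2}\widetilde C^{1/2}\beta_{s,j}}{(1-\epsilon_s)^{1/2}}M_{s-1,j}^{1/2}+\frac{\|K\|^{3/2}\langle\mu_s,\rho\rangle\beta_{s,j}}{(1-\epsilon_s)\,|\frac{\gamma_s}2-\langle\mu_{s|s-1},\rho\rangle|}M_{s-1,j}^{1/2}C_{s-1,j}^{1/2}+\|K\|\beta_{s,j}C_{s-1,j}^{1/2},$$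 $$\alpha_{s,j}=\|K\|^2\,\frac{\|\rho\|(\|\rho\phi_j^2\|+\frac{\gamma_s}2)}{\frac{\gamma_s}2\langle\mu_{s|s-1},\rho\rangle},\qquad \beta_{s,j}=\frac{\|\rho\|(\|\rho\phi_j\|+\frac{\gamma_s}2)}{\frac{\gamma_s}2\langle\mu_{s|s-1},\rho\rangle}.$$ In particular, for every $k\ge0$ and a.a. $i_k$, $e^{cond}_{k,N}(i_k)\to e^{cond}_{k,*}(i_k)$ as $N\to\infty$. -/

import Mathlib

open MeasureTheory ProbabilityTheory Filter Topology
open scoped ENNReal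

noncomputable section

namespace ParticleMSE

/-- `ℝⁿ` with the Euclidean norm. -/
abbrev E (n : ℕ) : Type := EuclideanSpace ℝ (Fin n)

/-- Values `(y₀, u₀, …, y_{k-1}, u_{k-1}, y_k)` of the information vector at time `k`. -/
abbrev Info (ny nu k : ℕ) : Type := (Fin (k + 1) → E ny) × (Fin k → E nu)

namespace Info

variable {ny nu k : ℕ}

/-- The information available one step before. -/
def past (i : Info ny nu (k + 1)) : Info ny nu k :=
  (fun s => i.1 s.castSucc, fun s => i.2 s.castSucc)

/-- The most recent observation `y_k`. -/
def obs (i : Info ny nu k) : E ny := i.1 (Fin.last k)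

/-- The most recent control `u_k` contained in `i_{k+1}`. -/
def ctrl (i : Info ny nu (k + 1)) : E nu := i.2 (Fin.last k)

end Info

/-- The information vector `I_k = (Y₀, U₀, …, Y_{k-1}, U_{k-1}, Y_k)`. -/
def infoVec {Ω : Type*} {ny nu : ℕ} (Y : ℕ → Ω → E ny) (U : ℕ → Ω → E nu) (k : ℕ) (ω : Ω) :
    Info ny nu k :=
  (fun s => Y s ω, fun s => U s ω)

/-- A partially observed controlled stochastic system
`X_{k+1} = f(X_k, U_k, ξ_k)`, `Y_k = h(X_k, η_k)`, `U_k = π_k(I_k)`,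
whose transition kernel and observation kernel have the densities `K` and `ρ`. -/
structure System (Ω : Type*) [MeasurableSpace Ω] (P : Measure Ω) (nx nu ny nξ nη : ℕ) where
  /-- dynamics -/
  f : E nx → E nu → E nξ → E nx
  measurable_f : Measurable fun q : E nx × E nu × E nξ => f q.1 q.2.1 q.2.2
  /-- observation map -/
  h : E nx → E nη → E ny
  measurable_h : Measurable fun q : E nx × E nη => h q.1 q.2
  /-- laws of the initial state and of the noises -/
  p₀ : Measure (E nx)
  pξ : Measure (E nξ)
  pη : Measure (E nη)
  /-- the density `K(z, x, u)` of the next state `z`, given the state `x` and the control `u` -/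
  K : E nx → E nx → E nu → ℝ≥0∞
  measurable_K : Measurable fun q : E nx × E nx × E nu => K q.1 q.2.1 q.2.2
  /-- the likelihood `ρ(y, x)` -/
  ρ : E ny → E nx → ℝ≥0∞
  measurable_ρ : Measurable fun q : E ny × E nx => ρ q.1 q.2
  /-- set of admissible control values -/
  admissible : Set (E nu)
  /-- control policy -/
  policy : (k : ℕ) → Info ny nu k → E nu
  measurable_policy : ∀ k, Measurable (policy k)
  policy_mem : ∀ k i, policy k i ∈ admissible
  /-- state, control, observation and noise processes -/
  X : ℕ → Ω → E nx
  U : ℕ → Ω → E nu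
  Y : ℕ → Ω → E ny
  ξ : ℕ → Ω → E nξ
  η : ℕ → Ω → E nη
  measurable_X : ∀ k, Measurable (X k)
  measurable_U : ∀ k, Measurable (U k)
  measurable_Y : ∀ k, Measurable (Y k)
  measurable_ξ : ∀ k, Measurable (ξ k)
  measurable_η : ∀ k, Measurable (η k)
  /-- the noises are i.i.d., and the initial state and the two noise sequences are independent -/
  law_X : P.map (X 0) = p₀
  law_ξ : ∀ k, P.map (ξ k) = pξ
  law_η : ∀ k, P.map (η k) = pη
  indep_ξ : iIndepFun ξ P
  indep_η : iIndepFun η P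
  indep_noises : IndepFun (fun ω k => ξ k ω) (fun ω k => η k ω) P
  indep_init : IndepFun (X 0) (fun ω => ((fun k => ξ k ω), (fun k => η k ω))) P
  dynamics : ∀ k ω, X (k + 1) ω = f (X k ω) (U k ω) (ξ k ω)
  observation : ∀ k ω, Y k ω = h (X k ω) (η k ω)
  control : ∀ k ω, U k ω = policy k (infoVec Y U k ω)
  /-- the law of `f(x, u, ξ)` is `K(z, x, u) dz` and the law of `h(x, η)` is `ρ(y, x) dy`
  (both densities therefore integrate to one) -/
  transition_density : ∀ x u, pξ.map (f x u) = volume.withDensity fun z => K z x u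
  observation_density : ∀ x, pη.map (h x) = volume.withDensity fun y => ρ y x

namespace System

variable {Ω : Type*} [MeasurableSpace Ω] {P : Measure Ω} [IsProbabilityMeasure P]
  {nx nu ny nξ nη : ℕ} (S : System Ω P nx nu ny nξ nη)

/-- The information vector `I_k`. -/
def I (k : ℕ) : Ω → Info ny nu k := infoVec S.Y S.U k

/-- The law of `I_k`; "for a.a. `i_k`" refers to it. -/
def infoLaw (k : ℕ) : Measure (Info ny nu k) := P.map (S.I k)

/-- The optimal filter `μ_k`: the conditional distribution of `X_k` given `I_k`. -/
def filter (k : ℕ) : Kernel (Info ny nu k) (E nx) := condDistrib (S.X k) (S.I k) P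

/-- The predictor `μ_{k+1|k}`: the conditional distribution of `X_{k+1}` given `I_k`. -/
def predictor (k : ℕ) : Kernel (Info ny nu k) (E nx) := condDistrib (S.X (k + 1)) (S.I k) P

/-- `⟨μ_{k+1|k}, ρ(y_{k+1}, ·)⟩` as a function of `i_{k+1}`. -/
def predLik (k : ℕ) (i : Info ny nu (k + 1)) : ℝ≥0∞ :=
  ∫⁻ x, S.ρ i.obs x ∂(S.predictor k i.past)

/-- `γ_{k+1}`: the infimum of `⟨μ_{k+1|k}, ρ⟩` over almost all `i_{k+1}`. -/
def gammaSucc (k : ℕ) : ℝ≥0∞ := essInf (S.predLik k) (S.infoLaw (k + 1))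

/-! ### The particle filter with selection -/

/-- The law `K(z, x, u) dz` of the next state. -/
def transition (x : E nx) (u : E nu) : Measure (E nx) := volume.withDensity fun z => S.K z x u

/-- One draw of predicted particles from the particles `x`: they are independent and the `i`-th one
has the law `∑ⱼ aᵢⱼ K(z, xⱼ, u) dz`. -/
def propose {N : ℕ} (a : Matrix (Fin N) (Fin N) ℝ) (u : E nu) (x : Fin N → E nx) :
    Measure (Fin N → E nx) :=
  Measure.pi fun i => ∑ j, ENNReal.ofReal (a i j) • S.transition (x j) u

/-- The average likelihood `N⁻¹ ∑ᵢ ρ(y, pᵢ)`, that is, the integral of `ρ(y, ·)` with respect to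
the empirical measure of the particles `p`. -/
def avgLik {N : ℕ} (y : E ny) (p : Fin N → E nx) : ℝ≥0∞ := (∑ i, S.ρ y (p i)) / N

/-- The selection step: predicted particles are drawn again from the same `x` until their average
likelihood is at least `t`, so that the accepted ones have the conditional law of a draw given this
event (and there are none, i.e. the measure is zero, if the event has probability zero). -/
def select {N : ℕ} (a : Matrix (Fin N) (Fin N) ℝ) (u : E nu) (y : E ny) (t : ℝ≥0∞)
    (x : Fin N → E nx) : Measure (Fin N → E nx) :=
  (S.propose a u x)[|{p | t ≤ S.avgLik y p}]

/-- The correction step: `N` independent draws from the particles `p` weighted proportionally to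
their likelihoods. -/
def resample {N : ℕ} (y : E ny) (p : Fin N → E nx) : Measure (Fin N → E nx) :=
  Measure.pi fun _ => ∑ j, (S.ρ y (p j) / ∑ l, S.ρ y (p l)) • Measure.dirac (p j)

/-- The conditional law, given `I_k = i_k`, of the `N` equally weighted particles that the filter
produces at time `k`. The selection threshold at time `k + 1` is `γ_{k+1} / 2`. The normalisation
conditions on the event that the selection steps terminate. -/
def particleLaw {N : ℕ} (a : ℕ → Matrix (Fin N) (Fin N) ℝ) :
    (k : ℕ) → Info ny nu k → Measure (Fin N → E nx)
  | 0, i => Measure.pi fun _ => S.filter 0 i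
  | k + 1, i =>
      let m := (particleLaw a k i.past).bind fun x =>
        (S.select (a k) i.ctrl i.obs (S.gammaSucc k / 2) x).bind (S.resample i.obs)
      (m Set.univ)⁻¹ • m

/-- The conditional law, given `I_{k+1} = i_{k+1}`, of the `N` predicted particles at time `k + 1`
(before the selection), whose empirical measure is `μ^N_{k+1|k}`. -/
def predictedLaw {N : ℕ} (a : ℕ → Matrix (Fin N) (Fin N) ℝ) (k : ℕ) (i : Info ny nu (k + 1)) :
    Measure (Fin N → E nx) :=
  (S.particleLaw a k i.past).bind (S.propose (a k) i.ctrl)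

/-! ### Mean square errors -/

/-- The empirical mean of equally weighted particles. -/
def mean {N : ℕ} (p : Fin N → E nx) : E nx := (N : ℝ)⁻¹ • ∑ i, p i

/-- The optimal conditional MSE `E[‖X_k - X̂*_k‖² | I_k = i_k]` with `X̂*_k = ⟨μ_k, Id⟩`. -/
def optMSE (k : ℕ) (i : Info ny nu k) : ℝ≥0∞ :=
  ∫⁻ x, ‖x - ∫ z, z ∂(S.filter k i)‖ₑ ^ 2 ∂(S.filter k i)

/-- The conditional MSE `E[‖X_k - X̂ᴺ_k‖² | I_k = i_k]`, also averaged over the particles;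
given `i_k`, the particles are generated independently of the state. -/
def particleMSE {N : ℕ} (a : ℕ → Matrix (Fin N) (Fin N) ℝ) (k : ℕ) (i : Info ny nu k) : ℝ≥0∞ :=
  ∫⁻ q, ‖q.1 - mean q.2‖ₑ ^ 2 ∂((S.filter k i).prod (S.particleLaw a k i))

/-- `‖φ_j‖_{k,2} = max(1, ⟨μ₀, φ_j²⟩^{1/2}, …, ⟨μ_k, φ_j²⟩^{1/2})`, with `φ_j(x) = x_j`. -/
def coordNorm (j : Fin nx) : (k : ℕ) → Info ny nu k → ℝ≥0∞
  | 0, i => max 1 ((∫⁻ x, ‖x j‖ₑ ^ 2 ∂(S.filter 0 i)) ^ (1 / 2 : ℝ))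
  | k + 1, i =>
      max (coordNorm j k i.past) ((∫⁻ x, ‖x j‖ₑ ^ 2 ∂(S.filter (k + 1) i)) ^ (1 / 2 : ℝ))

/-! ### Suprema and the recursion for the constants -/

/-- `‖K‖` for the control value `u`. -/
def normK (u : E nu) : ℝ≥0∞ := ⨆ (x₁ : E nx) (x₀ : E nx), S.K x₁ x₀ u

/-- `‖ρ φ_j^m‖` for the observation `y`. -/
def normRho (m : ℕ) (j : Fin nx) (y : E ny) : ℝ≥0∞ := ⨆ x : E nx, ‖x j‖ₑ ^ m * S.ρ y x

/-- `‖ρ‖` for the observation `y`. -/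
def supRho (y : E ny) : ℝ≥0∞ := ⨆ x : E nx, S.ρ y x

/-- `‖ρ‖ (‖ρ φ_j^m‖ + γ/2) / ((γ/2) ⟨μ_{k+1|k}, ρ⟩)` with `γ = γ_{k+1}`. -/
def ratio (m : ℕ) (j : Fin nx) (k : ℕ) (i : Info ny nu (k + 1)) : ℝ :=
  (S.supRho i.obs).toReal * ((S.normRho m j i.obs).toReal + (S.gammaSucc k).toReal / 2) /
    ((S.gammaSucc k).toReal / 2 * (S.predLik k i).toReal)

/-- `α_{k+1,j}` -/
def alpha (j : Fin nx) (k : ℕ) (i : Info ny nu (k + 1)) : ℝ :=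
  (S.normK i.ctrl).toReal ^ 2 * S.ratio 2 j k i

/-- `β_{k+1,j}` -/
def beta (j : Fin nx) (k : ℕ) (i : Info ny nu (k + 1)) : ℝ := S.ratio 1 j k i

/-- The pair `(M_{k,j}, C_{k,j})` as a function of `i_k`, the numbers `ε_k` and the constant `c`. -/
def coeff (ε : ℕ → ℝ) (c : ℝ) (j : Fin nx) : (k : ℕ) → Info ny nu k → ℝ × ℝ
  | 0, _ => (3, 8 * c)
  | k + 1, i =>
      let M' := (coeff ε c j k i.past).1
      let C' := (coeff ε c j k i.past).2
      let e := ε (k + 1)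
      let κ := (S.normK i.ctrl).toReal
      let r := (∫⁻ x, S.ρ i.obs x ∂(S.filter (k + 1) i)).toReal
      let M := 2 + S.alpha j k i * (1 + ((4 - e) / (1 - e) + 1) * M')
      let sqrtC := 2 ^ (3 / 2 : ℝ) * √c * √M
        + 2 ^ (3 / 2 : ℝ) * √c * S.beta j k i / √(1 - e) * √M'
        + κ ^ (3 / 2 : ℝ) * r * S.beta j k i /
            ((1 - e) * |(S.gammaSucc k).toReal / 2 - (S.predLik k i).toReal|) * √M' * √C'
        + κ * S.beta j k i * √C'
      (M, sqrtC ^ 2)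

/-! ### Assumptions -/

/-- Likelihood matching: `γ_k > 0` and, for a.a. `i_k` and all `N ≥ N_k(i_k)`, the average
likelihood of the predicted particles exceeds `γ_k` with conditional probability at least
`1 - ε_k` (for all `k ≥ 1`). -/
def LikelihoodMatching (a : (N : ℕ) → ℕ → Matrix (Fin N) (Fin N) ℝ) (ε : ℕ → ℝ)
    (N₀ : (k : ℕ) → Info ny nu k → ℕ) : Prop :=
  ∀ k, 0 < S.gammaSucc k ∧ ∀ᵐ i ∂(S.infoLaw (k + 1)), ∀ N ≥ N₀ (k + 1) i,
    ENNReal.ofReal (1 - ε (k + 1)) ≤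
      S.predictedLaw (a N) k i {p | S.gammaSucc k < S.avgLik i.obs p}

/-- The likelihood and the transition density are finite almost surely along the process. -/
def FiniteDensities : Prop :=
  ∀ k, ∀ᵐ ω ∂P, S.ρ (S.Y (k + 1) ω) (S.X (k + 1) ω) < ∞ ∧
    S.K (S.X (k + 1) ω) (S.X k ω) (S.U k ω) < ∞

/-- `‖K‖`, `‖ρ‖` and `‖ρ φ_j²‖` are finite for a.a. `i_k` (for all `k ≥ 1`). -/
def BoundedDensities : Prop :=
  ∀ k, ∀ᵐ i ∂(S.infoLaw (k + 1)), S.normK i.ctrl < ∞ ∧ S.supRho i.obs < ∞ ∧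
    ∀ j, S.normRho 2 j i.obs < ∞

end System

end ParticleMSE

end

/-!
The mean square error of the particle filter splits exactly: since the particles are independent of
the state given the information, `particleMSE` is `optMSE` plus the sum over the coordinates `j` of
the mean square error of the average of `x_j` over the particles
(`lintegral_prod_enorm_sub_mean_sq`). This gives the lower bound. The free constant `c` enters the
coefficient `C_{k,j}` with a factor at least one, all other terms being nonnegative (`le_coeff`), so
for the upper bound it is enough to bound these coordinate errors by a multiple of `1 / N` that may
depend on `i_k` in any way (`mse_bounds`). If the filter has no second moments, both errors are
infinite.

The `1 / N` bound is proved by induction on time for *bounded* test functions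
(`ae_meanSquareApprox`), and one step improves bounded functions to all `φ` for which `φ ρ` and
`φ² ρ` are bounded, among them the coordinates (`Dominated.lintegral_step_le`). The step consists
of the following estimates.

* Prediction: the mixing matrix has column sums one, so the conditional mean of the average of `φ`
  over the predicted particles is the average over the old particles of the transition operator
  applied to `φ`; the conditional variance is at most `sup φ² / N`
  (`MeanSquareApprox.lintegral_predict_le`).
* Selection: given the old particles, acceptance may be arbitrarily unlikely, so the conditional law
  cannot be compared with the unconditional one by a constant factor. If acceptance has probability
  at least one half, conditioning costs a factor two. Otherwise rejection has probability at least
  one half, and rejection means that the average likelihood misses `⟨μ_{k|k-1}, ρ⟩ ≥ γ` by `γ / 2`,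
  so by Chebyshev's inequality this event contributes `O(1 / N)`, because the error on accepted
  particles is bounded (`lintegral_cond_le`). Likelihood matching bounds the probability of
  termination from below (`Regular.predictedLaw_le_rawLaw_univ`).
* Correction: the weights of accepted particles are bounded, so resampling adds a variance of order
  `1 / N` (`lintegral_resample_le`), and the weighted averages are quotients whose denominators stay
  away from zero (`sq_div_sub_div_le`).

The optimal filter satisfies the matching recursion almost surely: Chapman–Kolmogorov
(`predictor_ae_eq`) and Bayes' formula (`filter_succ_ae_eq`), by independence of the noise from the
past. The number of particles is required to be large only for the present step; for the finitely
many `N` that are too small for an earlier step a bound without rate suffices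
(`Regular.lintegral_error_le_crude`).
-/

noncomputable section

namespace ParticleMSE

/-! ### Averages over independent particles -/

section Sampling

/-- The integral of `φ` with respect to the empirical measure of the particles `p`. -/
def avg {α : Type*} {N : ℕ} (φ : α → ℝ) (p : Fin N → α) : ℝ := (N : ℝ)⁻¹ * ∑ i, φ (p i)

lemma le_avg_iff {α : Type*} {N : ℕ} (hN : 0 < N) {φ : α → ℝ} {p : Fin N → α} {g : ℝ} :
    g ≤ avg φ p ↔ g * N ≤ ∑ l, φ (p l) := by
  have hN' : (0 : ℝ) < N := by exact_mod_cast hN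
  rw [avg, ← div_eq_inv_mul, le_div_iff₀ hN']

lemma inv_natCast_mul_sum_const {N : ℕ} (hN : 0 < N) (c : ℝ) : (N : ℝ)⁻¹ * ∑ _i : Fin N, c = c := by
  have : (N : ℝ) ≠ 0 := by exact_mod_cast hN.ne'
  simp; field_simp

lemma ofReal_div_natCast {N : ℕ} (hN : 0 < N) (B : ℝ) :
    ENNReal.ofReal (B / N) = ENNReal.ofReal B * (N : ℝ≥0∞)⁻¹ := by
  rw [ENNReal.ofReal_div_of_pos (by exact_mod_cast hN), ENNReal.ofReal_natCast, div_eq_mul_inv]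

variable {α : Type*} [MeasurableSpace α] {N : ℕ}

@[fun_prop]
lemma measurable_avg {φ : α → ℝ} (hφ : Measurable φ) : Measurable (avg φ : (Fin N → α) → ℝ) := by
  unfold avg; fun_prop

lemma ofReal_add_sq_le (a b : ℝ) :
    ENNReal.ofReal ((a + b) ^ 2) ≤ 2 * ENNReal.ofReal (a ^ 2) + 2 * ENNReal.ofReal (b ^ 2) := by
  have h2 : (2 : ℝ≥0∞) = ENNReal.ofReal 2 := by simp
  rw [h2, ← ENNReal.ofReal_mul two_pos.le, ← ENNReal.ofReal_mul two_pos.le,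
    ← ENNReal.ofReal_add (by positivity) (by positivity)]
  exact ENNReal.ofReal_le_ofReal (by nlinarith [sq_nonneg (a - b)])

lemma ofReal_sub_sq_le (a b c : ℝ) :
    ENNReal.ofReal ((a - c) ^ 2) ≤
      2 * ENNReal.ofReal ((a - b) ^ 2) + 2 * ENNReal.ofReal ((b - c) ^ 2) := by
  simpa using ofReal_add_sq_le (a - b) (b - c)

/-- The variance of the empirical average of independent particles is of order `1 / N`. -/
lemma lintegral_avg_sub_mean_sq_le (hN : 0 < N) (ν : Fin N → Measure α)
    [∀ i, IsProbabilityMeasure (ν i)] {φ : α → ℝ} (hφ : ∀ i, MemLp φ 2 (ν i)) {B : ℝ}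
    (hB : ∀ i, ∫ x, φ x ^ 2 ∂(ν i) ≤ B) :
    ∫⁻ p, ENNReal.ofReal ((avg φ p - (N : ℝ)⁻¹ * ∑ i, ∫ x, φ x ∂(ν i)) ^ 2) ∂(Measure.pi ν) ≤
      ENNReal.ofReal B * (N : ℝ≥0∞)⁻¹ := by
  have hN' : (0 : ℝ) < N := by exact_mod_cast hN
  set Z : (Fin N → α) → ℝ := ∑ i, fun p => (N : ℝ)⁻¹ * φ (p i) with hZ
  have hZa : ∀ p, Z p = avg φ p := fun p => by simp [hZ, avg, Finset.mul_sum]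
  have hmem : ∀ i, MemLp (fun p : Fin N → α => (N : ℝ)⁻¹ * φ (p i)) 2 (Measure.pi ν) := fun i =>
    ((hφ i).comp_measurePreserving (measurePreserving_eval ν i)).const_mul _
  have hZm : MemLp Z 2 (Measure.pi ν) := memLp_finsetSum' _ fun i _ => hmem i
  have hint : (Measure.pi ν)[Z] = (N : ℝ)⁻¹ * ∑ i, ∫ x, φ x ∂(ν i) := by
    simp only [hZ, Finset.sum_apply]
    rw [integral_finsetSum _ fun i _ => (hmem i).integrable (by norm_num), Finset.mul_sum]
    refine Finset.sum_congr rfl fun i _ => ?_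
    rw [integral_const_mul, integral_comp_eval (hφ i).aestronglyMeasurable]
  have hvar : Var[Z; Measure.pi ν] ≤ B / N := by
    rw [hZ, variance_sum_pi (X := fun _ x => (N : ℝ)⁻¹ * φ x) fun i => (hφ i).const_mul _]
    calc ∑ i, Var[fun x => (N : ℝ)⁻¹ * φ x; ν i] ≤ ∑ _i : Fin N, ((N : ℝ)⁻¹ ^ 2 * B) := by
          refine Finset.sum_le_sum fun i _ => ?_
          rw [variance_const_mul]
          gcongr
          exact (variance_le_expectation_sq (hφ i).aestronglyMeasurable).trans (hB i)
      _ = B / N := by simp; field_simp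
  have := ofReal_variance hZm
  rw [evariance_eq_lintegral_ofReal, hint] at this
  simp only [hZa] at this
  rw [← this, ← ofReal_div_natCast hN]
  exact ENNReal.ofReal_le_ofReal hvar

/-- Empirical averages around an arbitrary centre `c`: variance plus squared bias. -/
lemma lintegral_avg_sub_sq_le (hN : 0 < N) (ν : Fin N → Measure α)
    [∀ i, IsProbabilityMeasure (ν i)] {φ : α → ℝ} (hφ : ∀ i, MemLp φ 2 (ν i)) {B m : ℝ}
    (hB : ∀ i, ∫ x, φ x ^ 2 ∂(ν i) ≤ B) (hm : (N : ℝ)⁻¹ * ∑ i, ∫ x, φ x ∂(ν i) = m) (c : ℝ) :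
    ∫⁻ p, ENNReal.ofReal ((avg φ p - c) ^ 2) ∂(Measure.pi ν) ≤
      2 * (ENNReal.ofReal B * (N : ℝ≥0∞)⁻¹) + 2 * ENNReal.ofReal ((m - c) ^ 2) := by
  calc _ ≤ ∫⁻ p, (2 * ENNReal.ofReal ((avg φ p - m) ^ 2) + 2 * ENNReal.ofReal ((m - c) ^ 2))
        ∂(Measure.pi ν) := lintegral_mono fun p => ofReal_sub_sq_le _ _ _
    _ = 2 * ∫⁻ p, ENNReal.ofReal ((avg φ p - m) ^ 2) ∂(Measure.pi ν) +
        2 * ENNReal.ofReal ((m - c) ^ 2) := by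
      rw [lintegral_add_right _ measurable_const, lintegral_const_mul' _ _ (by simp)]
      simp
    _ ≤ _ := by
      gcongr
      rw [← hm]
      exact lintegral_avg_sub_mean_sq_le hN ν hφ hB

/-- A product of finite measures depends measurably on a parameter if its factors do. -/
lemma measurable_measure_pi {β ι : Type*} [MeasurableSpace β] [Fintype ι]
    {ν : β → ι → Measure α} [∀ b i, IsFiniteMeasure (ν b i)]
    (hν : ∀ i, Measurable fun b => ν b i) : Measurable fun b => Measure.pi (ν b) := by
  have key : ∀ s : ι → Set α, (∀ i, MeasurableSet (s i)) →
      Measurable fun b => Measure.pi (ν b) (Set.univ.pi s) := fun s hs => by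
    simp only [Measure.pi_pi]
    exact Finset.measurable_prod _ fun i _ => Measure.measurable_measure.1 (hν i) _ (hs i)
  refine .measure_of_isPiSystem generateFrom_pi.symm isPiSystem_pi ?_ ?_
  · rintro _ ⟨s, hs, rfl⟩
    exact key s fun i => hs i (Set.mem_univ i)
  · simpa using key (fun _ => Set.univ) fun _ => MeasurableSet.univ

/-- Conditioning on a fixed event, as a map between measures, is measurable. -/
lemma measurable_cond {A : Set α} (hA : MeasurableSet A) :
    Measurable fun μ : Measure α => μ[|A] := by
  refine Measure.measurable_of_measurable_coe _ fun s hs => ?_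
  simp only [cond_apply hA]
  exact (Measure.measurable_coe hA).inv.mul (Measure.measurable_coe (hA.inter hs))

/-- Redrawing until acceptance may have an arbitrarily small success probability. A bound `b` for
`R` on the event `A` pays for the case that the success probability is below one half, for then
rejection has probability at least one half; otherwise conditioning costs only a factor two. -/
lemma lintegral_cond_le (π : Measure α) [IsProbabilityMeasure π] {A : Set α}
    (hA : MeasurableSet A) {R G W : α → ℝ≥0∞} {b : ℝ≥0∞} (hb : ∀ p ∈ A, R p ≤ b)
    (hG : ∀ p ∈ A, R p ≤ G p) (hW : ∀ p ∉ A, 1 ≤ W p) :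
    ∫⁻ p, R p ∂(π[|A]) ≤ 2 * ∫⁻ p, G p ∂π + 2 * b * ∫⁻ p, W p ∂π := by
  rw [ProbabilityTheory.cond, lintegral_smul_measure, smul_eq_mul]
  by_cases h : 1 / 2 ≤ π A
  · refine le_add_right (mul_le_mul' ?_ ?_)
    · simpa using ENNReal.inv_le_inv.2 h
    · exact (setLIntegral_mono' hA hG).trans (setLIntegral_le_lintegral _ _)
  · refine le_add_left ?_
    have h1 : (π A)⁻¹ * ∫⁻ p in A, R p ∂π ≤ b := by
      calc _ ≤ (π A)⁻¹ * (b * π A) := by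
            gcongr
            exact (setLIntegral_mono' hA hb).trans (by simp)
        _ = b * ((π A)⁻¹ * π A) := by ring
        _ ≤ b := mul_le_of_le_one_right' (ENNReal.inv_mul_le_one _)
    have h2 : 1 / 2 ≤ ∫⁻ p, W p ∂π := by
      calc (1 / 2 : ℝ≥0∞) ≤ 1 - π A := by
            rw [← ENNReal.sub_half ENNReal.one_ne_top]
            exact tsub_le_tsub_left (not_le.1 h).le _
        _ = π Aᶜ := (prob_compl_eq_one_sub hA).symm
        _ = ∫⁻ p in Aᶜ, 1 ∂π := by simp
        _ ≤ ∫⁻ p in Aᶜ, W p ∂π := setLIntegral_mono' hA.compl hW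
        _ ≤ _ := setLIntegral_le_lintegral _ _
    calc _ ≤ b := h1
      _ = 2 * b * (1 / 2) := by
        rw [mul_comm 2 b, mul_assoc, one_div, ENNReal.mul_inv_cancel (by simp) (by simp), mul_one]
      _ ≤ _ := by gcongr

end Sampling

/-! ### Weighted resampling -/

section Weighted

variable {α : Type*} [MeasurableSpace α] {N : ℕ}

/-- The empirical measure of the particles `p` with weights proportional to `ρ`. -/
def weighted (ρ : α → ℝ≥0∞) (p : Fin N → α) : Measure α :=
  ∑ j, (ρ (p j) / ∑ l, ρ (p l)) • Measure.dirac (p j)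

variable {ρ : α → ℝ≥0∞} {p : Fin N → α}

instance : IsFiniteMeasure (weighted ρ p) := by
  refine ⟨?_⟩
  simp only [weighted, Measure.coe_finsetSum, Finset.sum_apply, Measure.smul_apply, measure_univ,
    smul_eq_mul, mul_one]
  refine ENNReal.sum_lt_top.2 fun j _ => ?_
  refine lt_of_le_of_lt (b := 1) ?_ ENNReal.one_lt_top
  refine (ENNReal.div_le_div_right ?_ _).trans ENNReal.div_self_le_one
  exact Finset.single_le_sum (f := fun l => ρ (p l)) (fun _ _ => zero_le) (Finset.mem_univ j)

lemma measurable_weighted (hρ : Measurable ρ) :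
    Measurable (weighted ρ : (Fin N → α) → Measure α) := by
  refine Measure.measurable_of_measurable_coe _ fun s hs => ?_
  simp only [weighted, Measure.coe_finsetSum, Finset.sum_apply, Measure.smul_apply, smul_eq_mul,
    Measure.dirac_apply' _ hs]
  refine Finset.measurable_fun_sum _ fun j _ => ?_
  refine Measurable.mul ?_ ?_
  · fun_prop
  · exact (measurable_const.indicator hs).comp (measurable_pi_apply j)

lemma isProbabilityMeasure_weighted (h0 : ∑ l, ρ (p l) ≠ 0) (ht : ∑ l, ρ (p l) ≠ ∞) :
    IsProbabilityMeasure (weighted ρ p) := by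
  refine ⟨?_⟩
  simp only [weighted, Measure.coe_finsetSum, Finset.sum_apply, Measure.smul_apply, measure_univ,
    smul_eq_mul, mul_one, div_eq_mul_inv]
  rw [← Finset.sum_mul, ENNReal.mul_inv_cancel h0 ht]

lemma integral_weighted (hfin : ∀ x, ρ x ≠ ∞) {φ : α → ℝ} (hφ : Measurable φ)
    (h0 : ∑ l, ρ (p l) ≠ 0) :
    ∫ x, φ x ∂(weighted ρ p) =
      avg (fun x => (ρ x).toReal * φ x) p / avg (fun x => (ρ x).toReal) p := by
  have hN : (N : ℝ) ≠ 0 := by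
    rintro h
    have : N = 0 := by exact_mod_cast h
    subst this
    simp at h0
  rw [weighted, integral_finsetSum_measure]
  · simp only [integral_smul_measure, integral_dirac' _ _ hφ.stronglyMeasurable]
    rw [avg, avg, mul_div_mul_left _ _ (inv_ne_zero hN), Finset.sum_div]
    refine Finset.sum_congr rfl fun j _ => ?_
    rw [ENNReal.toReal_div, ENNReal.toReal_sum fun l _ => hfin _, smul_eq_mul]
    ring
  · intro j _
    refine Integrable.smul_measure ?_ (ENNReal.div_ne_top (hfin _) h0)
    exact integrable_dirac' hφ.stronglyMeasurable (by simp)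

lemma memLp_weighted (hfin : ∀ x, ρ x ≠ ∞) {φ : α → ℝ} (hφ : Measurable φ)
    (h0 : ∑ l, ρ (p l) ≠ 0) : MemLp φ 2 (weighted ρ p) := by
  rw [memLp_two_iff_integrable_sq hφ.aestronglyMeasurable, weighted,
    integrable_finsetSum_measure]
  intro j _
  refine Integrable.smul_measure ?_ (ENNReal.div_ne_top (hfin _) h0)
  exact integrable_dirac' (hφ.pow_const 2).stronglyMeasurable (by simp)

/-- If `φ² ρ ≤ B` and the average weight is at least `g`, the second moment of `φ` under the
weighted empirical measure is at most `B / g`, whatever the particles are; this bounds the variance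
that resampling adds. -/
lemma lintegral_resample_le (hN : 0 < N) (hfin : ∀ x, ρ x ≠ ∞) {φ : α → ℝ}
    (hφ : Measurable φ) {B g : ℝ} (hg : 0 < g) (hB : ∀ x, (ρ x).toReal * φ x ^ 2 ≤ B)
    (hp : g ≤ avg (fun x => (ρ x).toReal) p) (c : ℝ) :
    ∫⁻ x, ENNReal.ofReal ((avg φ x - c) ^ 2) ∂(Measure.pi fun _ : Fin N => weighted ρ p) ≤
      2 * (ENNReal.ofReal (B / g) * (N : ℝ≥0∞)⁻¹) + 2 * ENNReal.ofReal
        ((avg (fun x => (ρ x).toReal * φ x) p / avg (fun x => (ρ x).toReal) p - c) ^ 2) := by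
  have hN' : (0 : ℝ) < N := by exact_mod_cast hN
  have h0 : ∑ l, ρ (p l) ≠ 0 := by
    intro h
    have := (le_avg_iff hN).1 hp
    rw [← ENNReal.toReal_sum fun l _ => hfin _, h] at this
    simp only [ENNReal.toReal_zero] at this
    nlinarith
  have := isProbabilityMeasure_weighted h0 (ENNReal.sum_ne_top.2 fun l _ => hfin (p l))
  have hB0 : 0 ≤ B := by
    have x : α := p ⟨0, hN⟩
    exact le_trans (by positivity) (hB x)
  refine lintegral_avg_sub_sq_le hN _ (fun _ => memLp_weighted hfin hφ h0) (fun _ => ?_) ?_ c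
  · rw [integral_weighted hfin (hφ.pow_const 2) h0]
    refine div_le_div₀ hB0 ?_ hg hp
    rw [avg]
    calc _ ≤ (N : ℝ)⁻¹ * ∑ _i : Fin N, B := by gcongr; exact hB _
      _ = B := by simp; field_simp
  · rw [Finset.sum_const, Finset.card_univ, Fintype.card_fin, nsmul_eq_mul, ← mul_assoc,
      inv_mul_cancel₀ hN'.ne', one_mul, integral_weighted hfin hφ h0]

end Weighted

/-! ### One step of the filter -/

section Step

lemma abs_avg_le {α : Type*} {N : ℕ} (hN : 0 < N) {φ : α → ℝ} {B : ℝ} (hB : ∀ x, |φ x| ≤ B)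
    (p : Fin N → α) : |avg φ p| ≤ B := by
  have hN' : (0 : ℝ) < N := by exact_mod_cast hN
  rw [avg, abs_mul, abs_of_pos (inv_pos.2 hN'), inv_mul_le_iff₀ hN']
  calc _ ≤ ∑ i, |φ (p i)| := Finset.abs_sum_le_sum_abs _ _
    _ ≤ ∑ _i : Fin N, B := Finset.sum_le_sum fun i _ => hB _
    _ = _ := by simp

variable {α : Type*} [MeasurableSpace α] {N : ℕ}

/-- The law of the `i`-th predicted particle: the mixture of the laws `τ (x j)` with the weights
in the `i`-th row of `a`. -/
def mixture (a : Matrix (Fin N) (Fin N) ℝ) (τ : α → Measure α) (x : Fin N → α) (i : Fin N) :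
    Measure α :=
  ∑ j, ENNReal.ofReal (a i j) • τ (x j)

variable {a : Matrix (Fin N) (Fin N) ℝ} {τ : α → Measure α}

lemma isProbabilityMeasure_mixture (ha : a ∈ doublyStochastic ℝ (Fin N))
    [∀ x, IsProbabilityMeasure (τ x)] (x : Fin N → α) (i : Fin N) :
    IsProbabilityMeasure (mixture a τ x i) := by
  refine ⟨?_⟩
  rw [mem_doublyStochastic_iff_sum] at ha
  simp only [mixture, Measure.coe_finsetSum, Finset.sum_apply, Measure.smul_apply, measure_univ,
    smul_eq_mul, mul_one]
  rw [← ENNReal.ofReal_sum_of_nonneg fun j _ => ha.1 i j, ha.2.1 i, ENNReal.ofReal_one]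

instance [∀ x, IsFiniteMeasure (τ x)] (x : Fin N → α) (i : Fin N) :
    IsFiniteMeasure (mixture a τ x i) := by
  have (j : Fin N) : IsFiniteMeasure (ENNReal.ofReal (a i j) • τ (x j)) :=
    Measure.smul_finite _ ENNReal.ofReal_ne_top
  unfold mixture
  infer_instance

lemma measurable_mixture (hτ : Measurable τ) (i : Fin N) :
    Measurable fun x : Fin N → α => mixture a τ x i := by
  refine Measure.measurable_of_measurable_coe _ fun s hs => ?_
  simp only [mixture, Measure.coe_finsetSum, Finset.sum_apply, Measure.smul_apply, smul_eq_mul]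
  refine Finset.measurable_fun_sum _ fun j _ => Measurable.const_mul ?_ _
  exact (Measure.measurable_measure.1 hτ s hs).comp (measurable_pi_apply j)

lemma integrable_of_abs_le {μ : Measure α} [IsFiniteMeasure μ] {φ : α → ℝ} (hφ : Measurable φ)
    {B : ℝ} (hB : ∀ x, |φ x| ≤ B) : Integrable φ μ :=
  Integrable.of_bound hφ.aestronglyMeasurable B (ae_of_all _ hB)

lemma abs_integral_le_of_abs_le {μ : Measure α} [IsProbabilityMeasure μ] {φ : α → ℝ}
    {B : ℝ} (hB : ∀ x, |φ x| ≤ B) : |∫ x, φ x ∂μ| ≤ B := by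
  have h := norm_integral_le_of_norm_le_const (μ := μ) (f := φ) (C := B) (ae_of_all _ hB)
  simpa using h

/-- Because the columns of `a` sum to one, the mean of the average over the predicted particles
is the average over the old particles of the transition operator applied to `φ`. -/
lemma mean_integral_mixture (ha : a ∈ doublyStochastic ℝ (Fin N))
    [∀ x, IsProbabilityMeasure (τ x)] {φ : α → ℝ} (hφ : Measurable φ) {B : ℝ}
    (hB : ∀ x, |φ x| ≤ B) (x : Fin N → α) :
    (N : ℝ)⁻¹ * ∑ i, ∫ z, φ z ∂(mixture a τ x i) = avg (fun z => ∫ w, φ w ∂(τ z)) x := by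
  rw [mem_doublyStochastic_iff_sum] at ha
  have h : ∀ i, ∫ z, φ z ∂(mixture a τ x i) = ∑ j, a i j * ∫ w, φ w ∂(τ (x j)) := fun i => by
    rw [mixture, integral_finsetSum_measure fun j _ =>
      (integrable_of_abs_le hφ hB).smul_measure ENNReal.ofReal_ne_top]
    simp only [integral_smul_measure, smul_eq_mul, ENNReal.toReal_ofReal (ha.1 i _)]
  simp only [h, avg]
  rw [Finset.sum_comm]
  simp only [← Finset.sum_mul, ha.2.2, one_mul]

/-- The error of the predicted particles, given the old ones. -/
lemma lintegral_predict_le (hN : 0 < N) (ha : a ∈ doublyStochastic ℝ (Fin N))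
    [∀ x, IsProbabilityMeasure (τ x)] {φ : α → ℝ} (hφ : Measurable φ) {B : ℝ}
    (hB : ∀ x, |φ x| ≤ B) (x : Fin N → α) (c : ℝ) :
    ∫⁻ p, ENNReal.ofReal ((avg φ p - c) ^ 2) ∂(Measure.pi (mixture a τ x)) ≤
      2 * (ENNReal.ofReal (B ^ 2) * (N : ℝ≥0∞)⁻¹) +
        2 * ENNReal.ofReal ((avg (fun z => ∫ w, φ w ∂(τ z)) x - c) ^ 2) := by
  have := isProbabilityMeasure_mixture (τ := τ) ha x
  refine lintegral_avg_sub_sq_le hN _ (fun i => ?_) (fun i => ?_)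
    (mean_integral_mixture ha hφ hB x) c
  · exact MemLp.of_bound hφ.aestronglyMeasurable B (ae_of_all _ hB)
  · refine (le_abs_self _).trans (abs_integral_le_of_abs_le fun z => ?_)
    rw [abs_pow]
    exact pow_le_pow_left₀ (abs_nonneg _) (hB z) 2

/-- The mean square error of the empirical averages of bounded functions over particles with the
law `L`, as an approximation of `μ`, is at most `D / N`, uniformly over the unit ball. -/
def MeanSquareApprox (L : Measure (Fin N → α)) (μ : Measure α) (D : ℝ≥0∞) : Prop :=
  ∀ φ : α → ℝ, Measurable φ → (∀ x, |φ x| ≤ 1) →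
    ∫⁻ x, ENNReal.ofReal ((avg φ x - ∫ z, φ z ∂μ) ^ 2) ∂L ≤ D * (N : ℝ≥0∞)⁻¹

lemma MeanSquareApprox.lintegral_le {L : Measure (Fin N → α)} {μ : Measure α} {D : ℝ≥0∞}
    (h : MeanSquareApprox L μ D) {φ : α → ℝ} (hφ : Measurable φ) {B : ℝ} (hB0 : 0 < B)
    (hB : ∀ x, |φ x| ≤ B) :
    ∫⁻ x, ENNReal.ofReal ((avg φ x - ∫ z, φ z ∂μ) ^ 2) ∂L ≤
      ENNReal.ofReal (B ^ 2) * (D * (N : ℝ≥0∞)⁻¹) := by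
  have h1 := h (fun x => B⁻¹ * φ x) (hφ.const_mul _) fun x => by
    rw [abs_mul, abs_of_pos (inv_pos.2 hB0), inv_mul_le_iff₀ hB0, mul_one]
    exact hB x
  have h2 : ∀ x : Fin N → α, ENNReal.ofReal ((avg φ x - ∫ z, φ z ∂μ) ^ 2) =
      ENNReal.ofReal (B ^ 2) *
        ENNReal.ofReal ((avg (fun x => B⁻¹ * φ x) x - ∫ z, B⁻¹ * φ z ∂μ) ^ 2) := fun x => by
    rw [← ENNReal.ofReal_mul (by positivity), ← mul_pow, integral_const_mul]
    congr 2
    simp only [avg, ← Finset.mul_sum]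
    field_simp
  simp only [h2]
  rw [lintegral_const_mul' _ _ ENNReal.ofReal_ne_top]
  gcongr

/-- The averaged error of the predicted particles as an approximation of the predictor `μ'`. -/
lemma MeanSquareApprox.lintegral_predict_le {L : Measure (Fin N → α)} {μ μ' : Measure α}
    {D : ℝ≥0∞} (h : MeanSquareApprox L μ D) (hL : L Set.univ ≤ 1) (hN : 0 < N)
    (ha : a ∈ doublyStochastic ℝ (Fin N)) [∀ x, IsProbabilityMeasure (τ x)]
    (hτ : Measurable τ) {φ : α → ℝ} (hφ : Measurable φ) {B : ℝ} (hB0 : 0 < B)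
    (hB : ∀ x, |φ x| ≤ B) (hμ' : ∫ z, φ z ∂μ' = ∫ x, ∫ z, φ z ∂(τ x) ∂μ) :
    ∫⁻ x, ∫⁻ p, ENNReal.ofReal ((avg φ p - ∫ z, φ z ∂μ') ^ 2) ∂(Measure.pi (mixture a τ x)) ∂L ≤
      ENNReal.ofReal (B ^ 2) * (2 + 2 * D) * (N : ℝ≥0∞)⁻¹ := by
  have hm : Measurable fun x => ∫ z, φ z ∂(τ x) :=
    (hφ.stronglyMeasurable.integral_kernel (κ := ⟨τ, hτ⟩)).measurable
  calc _ ≤ ∫⁻ x, (2 * (ENNReal.ofReal (B ^ 2) * (N : ℝ≥0∞)⁻¹) +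
        2 * ENNReal.ofReal ((avg (fun z => ∫ w, φ w ∂(τ z)) x - ∫ z, φ z ∂μ') ^ 2)) ∂L :=
        lintegral_mono fun x => ParticleMSE.lintegral_predict_le hN ha hφ hB x _
    _ = 2 * (ENNReal.ofReal (B ^ 2) * (N : ℝ≥0∞)⁻¹) * L Set.univ + 2 * ∫⁻ x,
        ENNReal.ofReal ((avg (fun z => ∫ w, φ w ∂(τ z)) x - ∫ z, φ z ∂μ') ^ 2) ∂L := by
      rw [lintegral_add_left measurable_const, lintegral_const, lintegral_const_mul' _ _ (by simp)]
    _ ≤ 2 * (ENNReal.ofReal (B ^ 2) * (N : ℝ≥0∞)⁻¹) * 1 +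
        2 * (ENNReal.ofReal (B ^ 2) * (D * (N : ℝ≥0∞)⁻¹)) := by
      rw [hμ']
      gcongr
      exact h.lintegral_le hm hB0 fun x => abs_integral_le_of_abs_le hB
    _ = _ := by ring

/-- Stability of the quotient `t / s` of a weighted mean `t` and a mean weight `s`. -/
lemma sq_div_sub_div_le {B g S T s t : ℝ} (hg : 0 < g) (hS : g ≤ S) (hs : 2 * g ≤ s)
    (ht : |t| ≤ B) :
    (T / S - t / s) ^ 2 ≤ 2 / g ^ 2 * (T - t) ^ 2 + 2 * B ^ 2 / g ^ 4 * (S - s) ^ 2 := by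
  have hS0 : 0 < S := hg.trans_le hS
  have hs0 : 0 < s := by linarith
  have e : T / S - t / s = (T - t) / S + t / s * ((s - S) / S) := by field_simp; ring
  have h1 : ((T - t) / S) ^ 2 ≤ (T - t) ^ 2 / g ^ 2 := by
    rw [div_pow]; gcongr
  have h2 : (t / s * ((s - S) / S)) ^ 2 ≤ B ^ 2 / g ^ 2 * ((S - s) ^ 2 / g ^ 2) := by
    rw [mul_pow, div_pow, div_pow, ← neg_sub S s, neg_sq]
    have : t ^ 2 ≤ B ^ 2 := sq_le_sq' (by linarith [(abs_le.1 ht).1]) (abs_le.1 ht).2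
    gcongr
    linarith
  rw [e]
  calc _ ≤ 2 * ((T - t) / S) ^ 2 + 2 * (t / s * ((s - S) / S)) ^ 2 := by
        nlinarith [sq_nonneg ((T - t) / S - t / s * ((s - S) / S))]
    _ ≤ 2 * ((T - t) ^ 2 / g ^ 2) + 2 * (B ^ 2 / g ^ 2 * ((S - s) ^ 2 / g ^ 2)) := by gcongr
    _ = _ := by field_simp

lemma sq_div_sub_div_le_const {B g S T s t : ℝ} (hg : 0 < g) (hS : g ≤ S) (hs : 2 * g ≤ s)
    (hT : |T| ≤ B) (ht : |t| ≤ B) : (T / S - t / s) ^ 2 ≤ (2 * B / g) ^ 2 := by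
  have hS0 : 0 < S := hg.trans_le hS
  have hs0 : 0 < s := by linarith
  have hB : 0 ≤ B := (abs_nonneg _).trans hT
  have h1 : |T / S| ≤ B / g := by rw [abs_div, abs_of_pos hS0]; gcongr
  have h2 : |t / s| ≤ B / g := by rw [abs_div, abs_of_pos hs0]; gcongr; linarith
  have h3 : |T / S - t / s| ≤ 2 * B / g := by
    calc _ ≤ |T / S| + |t / s| := abs_sub _ _
      _ ≤ B / g + B / g := add_le_add h1 h2
      _ = _ := by ring
  rw [← sq_abs]
  exact pow_le_pow_left₀ (abs_nonneg _) h3 2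

/-- The test functions `φ` for which `φ ρ` and `φ² ρ` are bounded by `B`. If the likelihood `ρ` is
bounded, they include the bounded functions, and also the coordinates if their squares times `ρ`
are bounded. -/
structure Dominated (ρ : α → ℝ≥0∞) (B : ℝ) (φ : α → ℝ) : Prop where
  measurable : Measurable φ
  abs_le : ∀ x, |(ρ x).toReal * φ x| ≤ B
  sq_le : ∀ x, (ρ x).toReal * φ x ^ 2 ≤ B

variable {ρ : α → ℝ≥0∞} {φ : α → ℝ} {B g : ℝ}

/-- A bound, independent of the particles and of their number, for the error after resampling. -/
def crudeConst (B g : ℝ) : ℝ≥0∞ :=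
  2 * ENNReal.ofReal (B / g) + 2 * ENNReal.ofReal ((2 * B / g) ^ 2)

lemma crudeConst_ne_top : crudeConst B g ≠ ∞ := by unfold crudeConst; finiteness

/-- If the mean square errors for bounded functions are at most `D / N` before a step of the filter,
those for functions dominated by `B` are at most `stepConst B g D / N` after the step, where `g` is
the selection threshold. The first summand comes from likely acceptance, the second one, with the
crude bound, from Chebyshev's inequality for the probability of rejection. -/
def stepConst (B g : ℝ) (D : ℝ≥0∞) : ℝ≥0∞ :=
  let V := ENNReal.ofReal (B ^ 2) * (2 + 2 * D)
  2 * (2 * ENNReal.ofReal (B / g) + 2 * (ENNReal.ofReal (2 / g ^ 2) * V +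
    ENNReal.ofReal (2 * B ^ 2 / g ^ 4) * V)) +
  2 * crudeConst B g * (ENNReal.ofReal (1 / g ^ 2) * V)

lemma stepConst_ne_top {D : ℝ≥0∞} (hD : D ≠ ∞) : stepConst B g D ≠ ∞ := by
  have := crudeConst_ne_top (B := B) (g := g)
  simp only [stepConst]; finiteness

lemma Dominated.resample_le_crude (hφ : Dominated ρ B φ) (hN : 0 < N) (hfin : ∀ x, ρ x ≠ ∞)
    (hg : 0 < g) {s t : ℝ} (hs : 2 * g ≤ s) (ht : |t| ≤ B) {p : Fin N → α}
    (hp : g ≤ avg (fun x => (ρ x).toReal) p) :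
    ∫⁻ x, ENNReal.ofReal ((avg φ x - t / s) ^ 2) ∂(Measure.pi fun _ : Fin N => weighted ρ p) ≤
      crudeConst B g := by
  refine (lintegral_resample_le hN hfin hφ.measurable hg hφ.sq_le hp _).trans ?_
  unfold crudeConst
  refine add_le_add (mul_le_mul' le_rfl ?_) (mul_le_mul' le_rfl (ENNReal.ofReal_le_ofReal ?_))
  · refine mul_le_of_le_one_right' (ENNReal.inv_le_one.2 ?_)
    exact_mod_cast hN
  · exact sq_div_sub_div_le_const hg hp hs (abs_avg_le hN hφ.abs_le p) ht

/-- One step of the filter maps an `O(1 / N)` mean square error for bounded functions to an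
`O(1 / N)` mean square error for dominated functions. -/
lemma Dominated.lintegral_step_le (hφ : Dominated ρ B φ) (hN : 0 < N) (hρ : Measurable ρ)
    (hfin : ∀ x, ρ x ≠ ∞) (hρB : ∀ x, (ρ x).toReal ≤ B) (hB0 : 0 < B) (hg : 0 < g)
    {L : Measure (Fin N → α)} {μ μ' : Measure α} [IsProbabilityMeasure μ'] {D : ℝ≥0∞}
    (h : MeanSquareApprox L μ D) (hL : L Set.univ ≤ 1)
    (ha : a ∈ doublyStochastic ℝ (Fin N)) [∀ x, IsProbabilityMeasure (τ x)] (hτ : Measurable τ)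
    (hμ' : ∀ ψ : α → ℝ, Measurable ψ → (∀ x, |ψ x| ≤ B) →
      ∫ z, ψ z ∂μ' = ∫ x, ∫ z, ψ z ∂(τ x) ∂μ)
    (hs : 2 * g ≤ ∫ x, (ρ x).toReal ∂μ') :
    ∫⁻ x, ∫⁻ p, ∫⁻ q, ENNReal.ofReal ((avg φ q -
          (∫ z, (ρ z).toReal * φ z ∂μ') / ∫ z, (ρ z).toReal ∂μ') ^ 2)
        ∂(Measure.pi fun _ : Fin N => weighted ρ p)
        ∂((Measure.pi (mixture a τ x))[|{p | g ≤ avg (fun x => (ρ x).toReal) p}]) ∂L ≤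
      stepConst B g D * (N : ℝ≥0∞)⁻¹ := by
  set r : α → ℝ := fun x => (ρ x).toReal with hr
  have hrm : Measurable r := hρ.ennreal_toReal
  have hrφ : Measurable fun x => r x * φ x := hrm.mul hφ.measurable
  have hrB : ∀ x, |r x| ≤ B := fun x => by rw [abs_of_nonneg ENNReal.toReal_nonneg]; exact hρB x
  set s := ∫ z, r z ∂μ' with hs'
  set t := ∫ z, r z * φ z ∂μ' with ht'
  have ht : |t| ≤ B := abs_integral_le_of_abs_le hφ.abs_le
  have hA : MeasurableSet {p : Fin N → α | g ≤ avg r p} :=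
    measurableSet_le measurable_const (measurable_avg hrm)
  set ET : (Fin N → α) → ℝ≥0∞ := fun p => ENNReal.ofReal ((avg (fun x => r x * φ x) p - t) ^ 2)
    with hET
  set ES : (Fin N → α) → ℝ≥0∞ := fun p => ENNReal.ofReal ((avg r p - s) ^ 2) with hES
  have hETm : Measurable ET := by fun_prop
  have hESm : Measurable ES := by fun_prop
  have hprob := fun x => isProbabilityMeasure_mixture (τ := τ) ha x
  have hmix : Measurable fun x : Fin N → α => Measure.pi (mixture a τ x) :=
    measurable_measure_pi fun i => measurable_mixture hτ i
  have hV1 := h.lintegral_predict_le hL hN ha hτ hrφ hB0 hφ.abs_le (hμ' _ hrφ hφ.abs_le)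
  have hV2 := h.lintegral_predict_le hL hN ha hτ hrm hB0 hrB (hμ' _ hrm hrB)
  set V := ENNReal.ofReal (B ^ 2) * (2 + 2 * D) with hV
  have hpt : ∀ x, ∫⁻ p, ∫⁻ q, ENNReal.ofReal ((avg φ q - t / s) ^ 2)
        ∂(Measure.pi fun _ : Fin N => weighted ρ p)
        ∂((Measure.pi (mixture a τ x))[|{p | g ≤ avg r p}]) ≤
      2 * (2 * (ENNReal.ofReal (B / g) * (N : ℝ≥0∞)⁻¹) +
        2 * (ENNReal.ofReal (2 / g ^ 2) * ∫⁻ p, ET p ∂(Measure.pi (mixture a τ x)) +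
        ENNReal.ofReal (2 * B ^ 2 / g ^ 4) * ∫⁻ p, ES p ∂(Measure.pi (mixture a τ x)))) +
      2 * crudeConst B g * (ENNReal.ofReal (1 / g ^ 2) *
        ∫⁻ p, ES p ∂(Measure.pi (mixture a τ x))) := by
    intro x
    refine (lintegral_cond_le _ hA (G := fun p => 2 * (ENNReal.ofReal (B / g) * (N : ℝ≥0∞)⁻¹) +
        2 * (ENNReal.ofReal (2 / g ^ 2) * ET p + ENNReal.ofReal (2 * B ^ 2 / g ^ 4) * ES p))
        (W := fun p => ENNReal.ofReal (1 / g ^ 2) * ES p) (b := crudeConst B g)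
        (fun p hp => hφ.resample_le_crude hN hfin hg hs ht hp) (fun p hp => ?_)
        (fun p hp => ?_)).trans_eq ?_
    · refine (lintegral_resample_le hN hfin hφ.measurable hg hφ.sq_le hp _).trans ?_
      gcongr
      simp only [hET, hES]
      rw [← ENNReal.ofReal_mul (by positivity), ← ENNReal.ofReal_mul (by positivity),
        ← ENNReal.ofReal_add (by positivity) (by positivity)]
      exact ENNReal.ofReal_le_ofReal (sq_div_sub_div_le hg hp hs ht)
    · simp only [hES]
      rw [← ENNReal.ofReal_mul (by positivity), ENNReal.one_le_ofReal, one_div,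
        ← div_eq_inv_mul, one_le_div (by positivity)]
      simp only [Set.mem_ofPred_eq, not_le] at hp
      nlinarith
    · rw [lintegral_add_left measurable_const, lintegral_const, measure_univ, mul_one,
        lintegral_const_mul' _ _ (by finiteness), lintegral_const_mul' _ _ (by finiteness),
        lintegral_add_left (hETm.const_mul _), lintegral_const_mul' _ _ (by finiteness),
        lintegral_const_mul' _ _ (by finiteness)]
  have hETi : Measurable fun x => ∫⁻ p, ET p ∂(Measure.pi (mixture a τ x)) :=
    (Measure.measurable_lintegral hETm).comp hmix
  have hESi : Measurable fun x => ∫⁻ p, ES p ∂(Measure.pi (mixture a τ x)) :=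
    (Measure.measurable_lintegral hESm).comp hmix
  refine (lintegral_mono hpt).trans ?_
  have hc := crudeConst_ne_top (B := B) (g := g)
  rw [lintegral_add_left (by fun_prop), lintegral_const_mul' _ _ (by finiteness),
    lintegral_add_left measurable_const, lintegral_const, lintegral_const_mul' _ _ (by finiteness),
    lintegral_const_mul' _ _ (by finiteness), lintegral_const_mul' _ _ (by finiteness),
    lintegral_add_left (hETi.const_mul _), lintegral_const_mul' _ _ (by finiteness),
    lintegral_const_mul' _ _ (by finiteness)]
  calc _ ≤ 2 * (2 * (ENNReal.ofReal (B / g) * (N : ℝ≥0∞)⁻¹) * 1 +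
        2 * (ENNReal.ofReal (2 / g ^ 2) * (V * (N : ℝ≥0∞)⁻¹) +
          ENNReal.ofReal (2 * B ^ 2 / g ^ 4) * (V * (N : ℝ≥0∞)⁻¹))) +
      2 * crudeConst B g * (ENNReal.ofReal (1 / g ^ 2) * (V * (N : ℝ≥0∞)⁻¹)) := by gcongr
    _ = _ := by simp only [stepConst]; ring

end Step

/-! ### The filtering recursion -/

section Independence

variable {Ω α β γ : Type*} [MeasurableSpace Ω] {P : Measure Ω} [IsProbabilityMeasure P]
  [MeasurableSpace α] [MeasurableSpace β] [MeasurableSpace γ]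

lemma indepFun_prodMk_of_indepFun {A : Ω → α} {B : Ω → β} {C : Ω → γ} (hA : Measurable A)
    (hB : Measurable B) (hC : Measurable C) (hAB : IndepFun A B P)
    (hABC : IndepFun (fun ω => (A ω, B ω)) C P) : IndepFun A (fun ω => (B ω, C ω)) P := by
  have hBC : IndepFun B C P := hABC.comp measurable_snd measurable_id
  have iA := Measure.isProbabilityMeasure_map (μ := P) hA.aemeasurable
  have iB := Measure.isProbabilityMeasure_map (μ := P) hB.aemeasurable
  have iC := Measure.isProbabilityMeasure_map (μ := P) hC.aemeasurable
  rw [indepFun_iff_map_prod_eq_prod_map_map (by fun_prop) (by fun_prop)] at hAB hBC hABC ⊢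
  rw [hBC, ← (measurePreserving_prodAssoc (P.map A) (P.map B) (P.map C)).map_eq, ← hAB, ← hABC,
    Measure.map_map (by fun_prop) (by fun_prop)]
  rfl

end Independence

namespace Info

variable {ny nu k : ℕ}

@[fun_prop]
lemma measurable_past : Measurable (past : Info ny nu (k + 1) → Info ny nu k) := by
  unfold past; fun_prop

@[fun_prop]
lemma measurable_obs : Measurable (obs : Info ny nu k → E ny) := by
  unfold obs; fun_prop

@[fun_prop]
lemma measurable_ctrl : Measurable (ctrl : Info ny nu (k + 1) → E nu) := by
  unfold ctrl; fun_prop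

/-- The information vector extended by a control and an observation. -/
def extend (i : Info ny nu k) (u : E nu) (y : E ny) : Info ny nu (k + 1) :=
  (Fin.snoc (α := fun _ => E ny) i.1 y, Fin.snoc (α := fun _ => E nu) i.2 u)

@[simp] lemma past_extend (i : Info ny nu k) (u : E nu) (y : E ny) :
    (i.extend u y).past = i := by
  simp [past, extend]

@[simp] lemma obs_extend (i : Info ny nu k) (u : E nu) (y : E ny) :
    (i.extend u y).obs = y := by
  simp [obs, extend]

@[simp] lemma ctrl_extend (i : Info ny nu k) (u : E nu) (y : E ny) :
    (i.extend u y).ctrl = u := by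
  simp [ctrl, extend]

lemma measurable_extend :
    Measurable fun q : Info ny nu k × E nu × E ny => q.1.extend q.2.1 q.2.2 := by
  unfold extend
  refine Measurable.prodMk ?_ ?_ <;> refine measurable_pi_lambda _ fun s => ?_
  · induction s using Fin.lastCases <;> simp only [Fin.snoc_last, Fin.snoc_castSucc] <;> fun_prop
  · induction s using Fin.lastCases <;> simp only [Fin.snoc_last, Fin.snoc_castSucc] <;> fun_prop

end Info

namespace System

variable {Ω : Type*} [MeasurableSpace Ω] {P : Measure Ω}
  {nx nu ny nξ nη : ℕ} (S : System Ω P nx nu ny nξ nη)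

lemma measurable_f_right (x : E nx) (u : E nu) : Measurable (S.f x u) :=
  S.measurable_f.comp (measurable_prodMk_left.comp measurable_prodMk_left)

lemma measurable_h_right (x : E nx) : Measurable (S.h x) :=
  S.measurable_h.comp measurable_prodMk_left

lemma transition_eq (x : E nx) (u : E nu) : S.transition x u = S.pξ.map (S.f x u) :=
  (S.transition_density x u).symm

lemma measurable_transition : Measurable fun q : E nx × E nu => S.transition q.1 q.2 := by
  refine Measure.measurable_of_measurable_coe _ fun s hs => ?_
  simp only [transition, withDensity_apply _ hs]
  refine Measurable.lintegral_prod_right' (ν := volume.restrict s)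
    (f := fun q : (E nx × E nu) × E nx => S.K q.2 q.1.1 q.1.2) ?_
  exact S.measurable_K.comp (measurable_snd.prodMk
    ((measurable_fst.comp measurable_fst).prodMk (measurable_snd.comp measurable_fst)))

lemma measurable_transition_left (u : E nu) : Measurable fun x => S.transition x u :=
  S.measurable_transition.comp (f := fun x => (x, u)) measurable_prodMk_right

lemma measurable_I (k : ℕ) : Measurable (S.I k) := by
  have := S.measurable_Y
  have := S.measurable_U
  unfold I infoVec; fun_prop

lemma I_succ (k : ℕ) (ω : Ω) :
    S.I (k + 1) ω = (S.I k ω).extend (S.policy k (S.I k ω)) (S.Y (k + 1) ω) := by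
  have hu : S.policy k (S.I k ω) = S.U k ω := (S.control k ω).symm
  rw [hu]
  refine Prod.ext (funext fun s => ?_) (funext fun s => ?_)
  · induction s using Fin.lastCases <;> simp [I, infoVec, Info.extend]
  · induction s using Fin.lastCases <;> simp [I, infoVec, Info.extend]

/-- The state and the information vector at time `n` are functions of the initial state, of the
system noise before `n` and of the observation noise up to `n`. -/
lemma measurable_state_info {Ω : Type*} {m m₀ : MeasurableSpace Ω} {P : Measure[m₀] Ω}
    (S : System Ω P nx nu ny nξ nη) (h0 : Measurable[m] (S.X 0)) (n : ℕ)
    (hξ : ∀ s < n, Measurable[m] (S.ξ s)) (hη : ∀ s ≤ n, Measurable[m] (S.η s)) :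
    Measurable[m] (S.X n) ∧ Measurable[m] (S.I n) := by
  have hY : ∀ n, Measurable[m] (S.X n) → Measurable[m] (S.η n) → Measurable[m] (S.Y n) :=
    fun n hX hη => by
      rw [funext (S.observation n)]
      exact S.measurable_h.comp (hX.prodMk hη)
  induction n with
  | zero =>
    refine ⟨h0, ?_⟩
    have h1 := hY 0 h0 (hη 0 le_rfl)
    refine Measurable.prodMk (@measurable_pi_lambda _ _ _ m _ _ fun s => ?_)
      (@measurable_pi_lambda _ _ _ m _ _ fun s => ?_)
    · rw [Fin.fin_one_eq_zero s]; exact h1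
    · exact s.elim0
  | succ n ih =>
    obtain ⟨hX, hI⟩ := ih (fun s hs => hξ s (by omega)) (fun s hs => hη s (by omega))
    have hU : Measurable[m] fun ω => S.policy n (S.I n ω) := (S.measurable_policy n).comp hI
    have hU' : Measurable[m] (S.U n) := by rw [funext (S.control n)]; exact hU
    have hX' : Measurable[m] (S.X (n + 1)) := by
      rw [funext (S.dynamics n)]
      exact S.measurable_f.comp (hX.prodMk (hU'.prodMk (hξ n (by omega))))
    refine ⟨hX', ?_⟩
    rw [funext (S.I_succ n)]
    exact Info.measurable_extend.comp (hI.prodMk (hU.prodMk (hY _ hX' (hη _ le_rfl))))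

lemma ae_past {k : ℕ} {p : Info ny nu k → Prop} (h : ∀ᵐ i ∂(S.infoLaw k), p i) :
    ∀ᵐ i ∂(S.infoLaw (k + 1)), p i.past := by
  refine ae_of_ae_map Info.measurable_past.aemeasurable ?_
  rw [infoLaw, Measure.map_map Info.measurable_past (S.measurable_I _)]
  exact h

lemma ae_ctrl_eq (k : ℕ) : ∀ᵐ i ∂(S.infoLaw (k + 1)), i.ctrl = S.policy k i.past := by
  have hm : MeasurableSet {i : Info ny nu (k + 1) | i.ctrl = S.policy k i.past} :=
    measurableSet_eq_fun Info.measurable_ctrl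
      ((S.measurable_policy k).comp Info.measurable_past)
  refine (ae_map_iff (S.measurable_I _).aemeasurable hm).2 (ae_of_all _ fun ω => ?_)
  rw [S.I_succ, Info.ctrl_extend, Info.past_extend]

variable [IsProbabilityMeasure P]

lemma isProbabilityMeasure_pξ : IsProbabilityMeasure S.pξ :=
  S.law_ξ 0 ▸ Measure.isProbabilityMeasure_map (S.measurable_ξ 0).aemeasurable

lemma isProbabilityMeasure_pη : IsProbabilityMeasure S.pη :=
  S.law_η 0 ▸ Measure.isProbabilityMeasure_map (S.measurable_η 0).aemeasurable

instance (x : E nx) (u : E nu) : IsProbabilityMeasure (S.transition x u) := by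
  have := S.isProbabilityMeasure_pξ
  rw [transition_eq]
  exact Measure.isProbabilityMeasure_map (S.measurable_f_right x u).aemeasurable

instance (k : ℕ) : IsProbabilityMeasure (S.infoLaw k) :=
  Measure.isProbabilityMeasure_map (S.measurable_I k).aemeasurable

instance (k : ℕ) : IsMarkovKernel (S.filter k) := by unfold filter; infer_instance

instance (k : ℕ) : IsMarkovKernel (S.predictor k) := by unfold predictor; infer_instance

/-- The system noise at time `k` is independent of the present state and information. -/
lemma indepFun_ξ (k : ℕ) : IndepFun (fun ω => (S.I k ω, S.X k ω)) (S.ξ k) P := by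
  have mξ := S.measurable_ξ
  have mη := S.measurable_η
  have mX := S.measurable_X
  set B : Ω → (Finset.range k → E nξ) := fun ω s => S.ξ s ω with hB
  set C : Ω → (ℕ → E nη) := fun ω s => S.η s ω with hC
  have hBm : Measurable B := measurable_pi_lambda _ fun s => mξ s
  have hCm : Measurable C := measurable_pi_lambda _ fun s => mη s
  have h1 : IndepFun (S.ξ k) B P :=
    (S.indep_ξ.indepFun_finset {k} (Finset.range k) (by simp) mξ).comp
      (measurable_pi_apply (⟨k, by simp⟩ : ({k} : Finset ℕ))) measurable_id
  have h2 : IndepFun (fun ω => (S.ξ k ω, B ω)) C P :=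
    S.indep_noises.comp (φ := fun z : ℕ → E nξ => (z k, fun s : Finset.range k => z s))
      (by fun_prop) measurable_id
  have h3 := indepFun_prodMk_of_indepFun (mξ k) hBm hCm h1 h2
  have h4 : IndepFun (fun ω => (S.ξ k ω, (B ω, C ω))) (S.X 0) P :=
    S.indep_init.symm.comp (φ := fun z : (ℕ → E nξ) × (ℕ → E nη) =>
      (z.1 k, ((fun s : Finset.range k => z.1 s), z.2))) (by fun_prop) measurable_id
  have h5 := (indepFun_prodMk_of_indepFun (mξ k) (hBm.prodMk hCm) (mX 0) h3 h4).symm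
  have hW : Measurable[MeasurableSpace.comap (fun ω => ((B ω, C ω), S.X 0 ω)) inferInstance]
    (fun ω => ((B ω, C ω), S.X 0 ω)) := comap_measurable _
  obtain ⟨hX, hI⟩ := S.measurable_state_info (measurable_snd.comp hW) k
    (fun s hs => (measurable_pi_apply (⟨s, by simpa using hs⟩ : Finset.range k)).comp
      ((measurable_fst.comp measurable_fst).comp hW))
    (fun s _ => (measurable_pi_apply s).comp ((measurable_snd.comp measurable_fst).comp hW))
  rw [IndepFun_iff_Indep] at h5 ⊢
  exact indep_of_indep_of_le_left h5 (hI.prodMk hX).comap_le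

/-- The observation noise at time `k + 1` is independent of the state at that time and of the
information available before. -/
lemma indepFun_η (k : ℕ) : IndepFun (fun ω => (S.I k ω, S.X (k + 1) ω)) (S.η (k + 1)) P := by
  have mξ := S.measurable_ξ
  have mη := S.measurable_η
  have mX := S.measurable_X
  set B : Ω → (Finset.range (k + 1) → E nη) := fun ω s => S.η s ω with hB
  set C : Ω → (ℕ → E nξ) := fun ω s => S.ξ s ω with hC
  have hBm : Measurable B := measurable_pi_lambda _ fun s => mη s
  have hCm : Measurable C := measurable_pi_lambda _ fun s => mξ s
  have h1 : IndepFun (S.η (k + 1)) B P :=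
    (S.indep_η.indepFun_finset {k + 1} (Finset.range (k + 1)) (by simp) mη).comp
      (measurable_pi_apply (⟨k + 1, by simp⟩ : ({k + 1} : Finset ℕ))) measurable_id
  have h2 : IndepFun (fun ω => (S.η (k + 1) ω, B ω)) C P :=
    S.indep_noises.symm.comp
      (φ := fun z : ℕ → E nη => (z (k + 1), fun s : Finset.range (k + 1) => z s))
      (by fun_prop) measurable_id
  have h3 := indepFun_prodMk_of_indepFun (mη (k + 1)) hBm hCm h1 h2
  have h4 : IndepFun (fun ω => (S.η (k + 1) ω, (B ω, C ω))) (S.X 0) P :=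
    S.indep_init.symm.comp (φ := fun z : (ℕ → E nξ) × (ℕ → E nη) =>
      (z.2 (k + 1), ((fun s : Finset.range (k + 1) => z.2 s), z.1))) (by fun_prop) measurable_id
  have h5 := (indepFun_prodMk_of_indepFun (mη (k + 1)) (hBm.prodMk hCm) (mX 0) h3 h4).symm
  have hW : Measurable[MeasurableSpace.comap (fun ω => ((B ω, C ω), S.X 0 ω)) inferInstance]
    (fun ω => ((B ω, C ω), S.X 0 ω)) := comap_measurable _
  have hWξ : ∀ s, Measurable[MeasurableSpace.comap (fun ω => ((B ω, C ω), S.X 0 ω))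
      inferInstance] (S.ξ s) := fun s =>
    (measurable_pi_apply s).comp ((measurable_snd.comp measurable_fst).comp hW)
  obtain ⟨hX, hI⟩ := S.measurable_state_info (measurable_snd.comp hW) k (fun s _ => hWξ s)
    (fun s hs => (measurable_pi_apply
      (⟨s, Finset.mem_range.2 (Nat.lt_succ_of_le hs)⟩ : Finset.range (k + 1))).comp
      ((measurable_fst.comp measurable_fst).comp hW))
  have hU : Measurable[MeasurableSpace.comap (fun ω => ((B ω, C ω), S.X 0 ω)) inferInstance]
      (S.U k) := by
    rw [funext (S.control k)]
    exact (S.measurable_policy k).comp hI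
  have hX' : Measurable[MeasurableSpace.comap (fun ω => ((B ω, C ω), S.X 0 ω)) inferInstance]
      (S.X (k + 1)) := by
    rw [funext (S.dynamics k)]
    exact S.measurable_f.comp (hX.prodMk (hU.prodMk (hWξ k)))
  rw [IndepFun_iff_Indep] at h5 ⊢
  exact indep_of_indep_of_le_left h5 (hI.prodMk hX').comap_le

/-- The transition kernel of the controlled system, as a kernel from information and state. -/
def transitionKernel (k : ℕ) : Kernel (Info ny nu k × E nx) (E nx) :=
  Kernel.comap ⟨fun q : E nx × E nu => S.transition q.1 q.2, S.measurable_transition⟩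
    (fun q => (q.2, S.policy k q.1))
    (measurable_snd.prodMk ((S.measurable_policy k).comp measurable_fst))

instance (k : ℕ) : IsMarkovKernel (S.transitionKernel k) :=
  ⟨fun q => inferInstanceAs (IsProbabilityMeasure (S.transition q.2 (S.policy k q.1)))⟩

lemma infoLaw_compProd_filter (k : ℕ) :
    S.infoLaw k ⊗ₘ S.filter k = P.map fun ω => (S.I k ω, S.X k ω) :=
  compProd_map_condDistrib (S.measurable_X k).aemeasurable

lemma infoLaw_compProd_predictor (k : ℕ) :
    S.infoLaw k ⊗ₘ S.predictor k = P.map fun ω => (S.I k ω, S.X (k + 1) ω) :=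
  compProd_map_condDistrib (S.measurable_X (k + 1)).aemeasurable

/-- Chapman–Kolmogorov: the predictor is the image of the filter under the transition kernel. -/
lemma predictor_ae_eq (k : ℕ) :
    S.predictor k =ᵐ[S.infoLaw k] (S.filter k ⊗ₖ S.transitionKernel k).snd := by
  have mI := S.measurable_I k
  have mX := S.measurable_X
  have mξ := S.measurable_ξ k
  have mp := S.measurable_policy k
  have := S.isProbabilityMeasure_pξ
  refine condDistrib_ae_eq_of_measure_eq_compProd _ (mX (k + 1)).aemeasurable ?_
  refine Measure.ext_of_lintegral _ fun F hF => ?_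
  have mf : Measurable fun q : (Info ny nu k × E nx) × E nξ =>
      S.f q.1.2 (S.policy k q.1.1) q.2 :=
    S.measurable_f.comp (f := fun q : (Info ny nu k × E nx) × E nξ =>
      (q.1.2, S.policy k q.1.1, q.2)) (by fun_prop)
  have mF : Measurable fun q : (Info ny nu k × E nx) × E nξ =>
      F (q.1.1, S.f q.1.2 (S.policy k q.1.1) q.2) := by fun_prop
  have hdyn : ∀ ω, S.X (k + 1) ω = S.f (S.X k ω) (S.policy k (S.I k ω)) (S.ξ k ω) := fun ω => by
    rw [S.dynamics, S.control]; rfl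
  have hprod := (indepFun_iff_map_prod_eq_prod_map_map (by fun_prop) (by fun_prop)).1
    (S.indepFun_ξ k)
  rw [S.law_ξ, ← S.infoLaw_compProd_filter] at hprod
  rw [lintegral_map hF (by fun_prop)]
  simp only [hdyn]
  rw [← lintegral_map (f := fun q : (Info ny nu k × E nx) × E nξ =>
    F (q.1.1, S.f q.1.2 (S.policy k q.1.1) q.2)) (g := fun ω => ((S.I k ω, S.X k ω), S.ξ k ω))
    mF (by fun_prop), hprod, lintegral_prod _ mF.aemeasurable,
    Measure.lintegral_compProd mF.lintegral_prod_right', Measure.lintegral_compProd hF]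
  refine lintegral_congr fun i => ?_
  have hFi : Measurable fun z => F (i, z) := hF.comp measurable_prodMk_left
  rw [Kernel.lintegral_snd _ _ hFi,
    Kernel.lintegral_compProd (f := fun q : E nx × E nx => F (i, q.2)) _ _ _
    (hFi.comp measurable_snd)]
  refine lintegral_congr fun x => ?_
  change _ = ∫⁻ z, F (i, z) ∂(S.transition x (S.policy k i))
  rw [S.transition_eq, lintegral_map hFi (S.measurable_f_right _ _)]

lemma ae_integral_predictor (k : ℕ) :
    ∀ᵐ i ∂(S.infoLaw k), ∀ ψ : E nx → ℝ, Measurable ψ → ∀ B, (∀ x, |ψ x| ≤ B) →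
      ∫ z, ψ z ∂(S.predictor k i) =
        ∫ x, ∫ z, ψ z ∂(S.transition x (S.policy k i)) ∂(S.filter k i) := by
  filter_upwards [S.predictor_ae_eq k] with i hi ψ hψ B hB
  rw [hi, Kernel.snd_apply, integral_map measurable_snd.aemeasurable hψ.aestronglyMeasurable,
    ProbabilityTheory.integral_compProd (f := fun q : E nx × E nx => ψ q.2)
      (integrable_of_abs_le (hψ.comp measurable_snd) fun q => hB q.2)]
  rfl

/-- The joint law of the information and the state at time `k + 1`. -/
lemma lintegral_info_state (k : ℕ) {F : Info ny nu (k + 1) × E nx → ℝ≥0∞} (hF : Measurable F) :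
    ∫⁻ ω, F (S.I (k + 1) ω, S.X (k + 1) ω) ∂P =
      ∫⁻ i, ∫⁻ y, ∫⁻ x, S.ρ y x * F (i.extend (S.policy k i) y, x)
        ∂(S.predictor k i) ∂volume ∂(S.infoLaw k) := by
  have mI := S.measurable_I k
  have mX := S.measurable_X
  have mη := S.measurable_η (k + 1)
  have mp := S.measurable_policy k
  have := S.isProbabilityMeasure_pη
  have me : Measurable fun q : (Info ny nu k × E nx) × E ny =>
      q.1.1.extend (S.policy k q.1.1) q.2 :=
    Info.measurable_extend.comp (f := fun q : (Info ny nu k × E nx) × E ny =>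
      (q.1.1, S.policy k q.1.1, q.2)) (by fun_prop)
  have mF0 : Measurable fun q : (Info ny nu k × E nx) × E ny =>
      F (q.1.1.extend (S.policy k q.1.1) q.2, q.1.2) := by fun_prop
  have mh : Measurable fun q : (Info ny nu k × E nx) × E nη => S.h q.1.2 q.2 :=
    S.measurable_h.comp (f := fun q : (Info ny nu k × E nx) × E nη => (q.1.2, q.2)) (by fun_prop)
  have mF : Measurable fun q : (Info ny nu k × E nx) × E nη =>
      F (q.1.1.extend (S.policy k q.1.1) (S.h q.1.2 q.2), q.1.2) :=
    mF0.comp (f := fun q : (Info ny nu k × E nx) × E nη => (q.1, S.h q.1.2 q.2)) (by fun_prop)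
  have hprod := (indepFun_iff_map_prod_eq_prod_map_map (by fun_prop) (by fun_prop)).1
    (S.indepFun_η k)
  rw [S.law_η, ← S.infoLaw_compProd_predictor] at hprod
  simp only [S.I_succ, S.observation]
  rw [← lintegral_map (f := fun q : (Info ny nu k × E nx) × E nη =>
    F (q.1.1.extend (S.policy k q.1.1) (S.h q.1.2 q.2), q.1.2))
    (g := fun ω => ((S.I k ω, S.X (k + 1) ω), S.η (k + 1) ω))
    mF (by fun_prop), hprod, lintegral_prod _ mF.aemeasurable,
    Measure.lintegral_compProd mF.lintegral_prod_right']
  refine lintegral_congr fun i => ?_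
  have mi : Measurable fun q : E nx × E ny => F (i.extend (S.policy k i) q.2, q.1) :=
    mF0.comp (f := fun q : E nx × E ny => ((i, q.1), q.2)) (by fun_prop)
  have mρ : Measurable fun q : E nx × E ny => S.ρ q.2 q.1 :=
    S.measurable_ρ.comp measurable_swap
  rw [lintegral_lintegral_swap (f := fun y x => S.ρ y x * F (i.extend (S.policy k i) y, x))
    ((mρ.mul mi).comp measurable_swap).aemeasurable]
  refine lintegral_congr fun x => ?_
  have mix : Measurable fun y => F (i.extend (S.policy k i) y, x) :=
    mi.comp measurable_prodMk_left
  have hx := lintegral_withDensity_eq_lintegral_mul volume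
    (mρ.comp (measurable_prodMk_left (x := x))) mix
  refine Eq.trans ?_ hx
  change _ = ∫⁻ y, _ ∂(volume.withDensity fun y => S.ρ y x)
  rw [← S.observation_density x, lintegral_map mix (S.measurable_h_right x)]

lemma measurable_predLik (k : ℕ) : Measurable (S.predLik k) := by
  unfold predLik
  refine Measurable.lintegral_kernel_prod_right' (κ := (S.predictor k).comap _ Info.measurable_past)
    (f := fun q : Info ny nu (k + 1) × E nx => S.ρ q.1.obs q.2) ?_
  exact S.measurable_ρ.comp (f := fun q : Info ny nu (k + 1) × E nx => (q.1.obs, q.2))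
    (by fun_prop)

/-- The posterior distribution given by Bayes' formula. -/
def bayes (k : ℕ) : Kernel (Info ny nu (k + 1)) (E nx) :=
  ((S.predictor k).comap _ Info.measurable_past).withDensity
    fun i x => S.ρ i.obs x * (S.predLik k i)⁻¹

lemma measurable_bayes_density (k : ℕ) :
    Measurable (Function.uncurry fun (i : Info ny nu (k + 1)) x =>
      S.ρ i.obs x * (S.predLik k i)⁻¹) := by
  have h1 := S.measurable_predLik k
  have h2 : Measurable fun q : Info ny nu (k + 1) × E nx => S.ρ q.1.obs q.2 :=
    S.measurable_ρ.comp (f := fun q : Info ny nu (k + 1) × E nx => (q.1.obs, q.2)) (by fun_prop)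
  exact h2.mul (h1.inv.comp measurable_fst)

lemma bayes_apply (k : ℕ) (i : Info ny nu (k + 1)) :
    S.bayes k i =
      (S.predictor k i.past).withDensity fun x => S.ρ i.obs x * (S.predLik k i)⁻¹ := by
  rw [bayes, Kernel.withDensity_apply _ (S.measurable_bayes_density k)]
  rfl

instance (k : ℕ) : IsFiniteKernel (S.bayes k) := by
  refine ⟨1, ENNReal.one_lt_top, fun i => ?_⟩
  have hρ : Measurable fun x => S.ρ i.obs x := S.measurable_ρ.comp measurable_prodMk_left
  rw [bayes_apply, withDensity_apply _ MeasurableSet.univ, Measure.restrict_univ,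
    lintegral_mul_const _ hρ]
  exact ENNReal.mul_inv_le_one _

/-- Bayes' formula for the optimal filter. -/
lemma filter_succ_ae_eq (k : ℕ) : S.filter (k + 1) =ᵐ[S.infoLaw (k + 1)] S.bayes k := by
  have mI := S.measurable_I (k + 1)
  have mX := S.measurable_X (k + 1)
  have mL := S.measurable_predLik k
  refine condDistrib_ae_eq_of_measure_eq_compProd _ mX.aemeasurable ?_
  refine Measure.ext_of_lintegral _ fun F hF => ?_
  have mG : Measurable fun j => ∫⁻ x, F (j, x) ∂(S.bayes k j) := hF.lintegral_kernel_prod_right'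
  rw [lintegral_map hF (by fun_prop), S.lintegral_info_state k hF, Measure.lintegral_compProd hF,
    lintegral_map mG mI, S.lintegral_info_state k (F := fun q => ∫⁻ x, F (q.1, x) ∂(S.bayes k q.1))
      (mG.comp measurable_fst)]
  refine lintegral_congr fun i => ?_
  have mρ : Measurable fun q : E nx × E ny => S.ρ q.2 q.1 :=
    S.measurable_ρ.comp measurable_swap
  have hlik : ∀ y, S.predLik k (i.extend (S.policy k i) y) =
      ∫⁻ x, S.ρ y x ∂(S.predictor k i) := fun y => by simp [predLik]
  -- The predicted likelihood is a probability density in `y`, hence finite almost everywhere.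
  have hfin : ∀ᵐ y : E ny, ∫⁻ x, S.ρ y x ∂(S.predictor k i) < ∞ := by
    refine ae_lt_top S.measurable_ρ.lintegral_prod_right' ?_
    rw [lintegral_lintegral_swap (mρ.comp measurable_swap).aemeasurable]
    have : ∀ x, ∫⁻ y, S.ρ y x = 1 := fun x => by
      have h := congrArg (fun m => m Set.univ) (S.observation_density x)
      have := S.isProbabilityMeasure_pη
      have : IsProbabilityMeasure (S.pη.map (S.h x)) :=
        Measure.isProbabilityMeasure_map (S.measurable_h_right x).aemeasurable
      rw [withDensity_apply _ MeasurableSet.univ, Measure.restrict_univ] at h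
      rw [← h]
      exact measure_univ
    simp [this]
  refine lintegral_congr_ae ?_
  filter_upwards [hfin] with y hy
  have mρy : Measurable fun x => S.ρ y x := mρ.comp measurable_prodMk_right
  have mFy : Measurable fun x => F (i.extend (S.policy k i) y, x) :=
    hF.comp measurable_prodMk_left
  rw [lintegral_mul_const _ mρy, bayes_apply, hlik, Info.obs_extend, Info.past_extend,
    lintegral_withDensity_eq_lintegral_mul _ (mρy.mul_const _) mFy]
  simp only [Pi.mul_apply]
  have e : ∀ x, S.ρ y x * (∫⁻ x, S.ρ y x ∂(S.predictor k i))⁻¹ *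
      F (i.extend (S.policy k i) y, x) = (∫⁻ x, S.ρ y x ∂(S.predictor k i))⁻¹ *
      (S.ρ y x * F (i.extend (S.policy k i) y, x)) := fun x => by ring
  simp only [e]
  have mρF : Measurable fun x => S.ρ y x * F (i.extend (S.policy k i) y, x) := mρy.mul mFy
  rw [lintegral_const_mul _ mρF, ← mul_assoc]
  by_cases h0 : ∫⁻ x, S.ρ y x ∂(S.predictor k i) = 0
  · rw [h0, zero_mul, zero_mul]
    rw [lintegral_eq_zero_iff mρy] at h0
    rw [lintegral_eq_zero_iff mρF]
    filter_upwards [h0] with x hx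
    simp only [Pi.zero_apply] at hx
    simp [hx]
  · rw [ENNReal.mul_inv_cancel h0 hy.ne, one_mul]

end System

/-! ### Mean square errors and the coefficients -/

section MeanSquare

variable {n : ℕ}

/-- Bias–variance decomposition of the mean square deviation from `c`. -/
lemma lintegral_enorm_sub_sq_eq {μ : Measure (E n)} [IsProbabilityMeasure μ]
    (h : MemLp (fun x : E n => x) 2 μ) (c : E n) :
    ∫⁻ x, ‖x - c‖ₑ ^ 2 ∂μ =
      ∫⁻ x, ‖x - ∫ z, z ∂μ‖ₑ ^ 2 ∂μ + ENNReal.ofReal (‖(∫ z, z ∂μ) - c‖ ^ 2) := by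
  set m := ∫ z, z ∂μ with hm
  have hi : Integrable (fun x : E n => x) μ := h.integrable (by norm_num)
  have hsub : ∀ d : E n, Integrable (fun x => ‖x - d‖ ^ 2) μ := fun d =>
    (h.sub (memLp_const d)).integrable_norm_pow (by norm_num)
  have hconv : ∀ d : E n, ∫⁻ x, ‖x - d‖ₑ ^ 2 ∂μ = ENNReal.ofReal (∫ x, ‖x - d‖ ^ 2 ∂μ) :=
      fun d => by
    rw [ofReal_integral_eq_lintegral_ofReal (hsub d) (ae_of_all _ fun x => by positivity)]
    refine lintegral_congr fun x => ?_
    rw [ENNReal.ofReal_pow (norm_nonneg _), ofReal_norm]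
  have hinner : Integrable (fun x => inner ℝ (m - c) (x - m)) μ :=
    (hi.sub (integrable_const m)).const_inner (m - c)
  have hexp : ∀ x : E n, ‖x - c‖ ^ 2 = (‖x - m‖ ^ 2 + ‖m - c‖ ^ 2) + 2 * inner ℝ (m - c) (x - m) :=
    fun x => by
      rw [show x - c = (x - m) + (m - c) by abel, norm_add_sq_real, real_inner_comm]
      ring
  have hz : ∫ x, inner ℝ (m - c) (x - m) ∂μ = 0 := by
    have him : Integrable (fun x : E n => x - m) μ := hi.sub (integrable_const m)
    rw [integral_inner him, integral_sub hi (integrable_const m)]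
    simp [hm]
  rw [hconv, hconv, ← ENNReal.ofReal_add (integral_nonneg fun x => by positivity) (by positivity)]
  congr 1
  have hvar : Integrable (fun x : E n => ‖x - m‖ ^ 2 + ‖m - c‖ ^ 2) μ :=
    (hsub m).add (integrable_const _)
  rw [integral_congr_ae (ae_of_all _ hexp), integral_add hvar (hinner.const_mul 2),
    integral_add (hsub m) (integrable_const _), integral_const_mul, hz]
  simp

lemma lintegral_enorm_sub_sq_eq_top {μ : Measure (E n)} [IsProbabilityMeasure μ]
    (h : ¬ MemLp (fun x : E n => x) 2 μ) (c : E n) : ∫⁻ x, ‖x - c‖ₑ ^ 2 ∂μ = ∞ := by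
  by_contra hne
  refine h ?_
  have h1 : MemLp (fun x : E n => x - c) 2 μ := by
    refine (memLp_two_iff_integrable_sq_norm (by fun_prop)).2 ⟨by fun_prop, ?_⟩
    simpa [HasFiniteIntegral, lt_top_iff_ne_top] using hne
  have h2 := h1.add (memLp_const c)
  rwa [show ((fun x : E n => x - c) + fun _ => c) = fun x => x by ext; simp] at h2

lemma mean_apply {N : ℕ} (p : Fin N → E n) (j : Fin n) :
    System.mean p j = avg (fun x : E n => x j) p := by
  simp [System.mean, avg]

/-- The mean square error of an estimate by independent particles is the optimal one plus the mean
square errors of the coordinates of the empirical mean. -/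
lemma lintegral_prod_enorm_sub_mean_sq {N : ℕ} {μ : Measure (E n)} [IsProbabilityMeasure μ]
    {L : Measure (Fin N → E n)} [IsProbabilityMeasure L] (h : MemLp (fun x : E n => x) 2 μ) :
    ∫⁻ q, ‖q.1 - System.mean q.2‖ₑ ^ 2 ∂(μ.prod L) = ∫⁻ x, ‖x - ∫ z, z ∂μ‖ₑ ^ 2 ∂μ +
      ∑ j, ∫⁻ q, ENNReal.ofReal ((avg (fun x : E n => x j) q - ∫ x : E n, x j ∂μ) ^ 2) ∂L := by
  have hmm : Measurable (System.mean : (Fin N → E n) → E n) := by unfold System.mean; fun_prop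
  have hm : Measurable fun q : E n × (Fin N → E n) => ‖q.1 - System.mean q.2‖ₑ ^ 2 := by fun_prop
  have hi : Integrable (fun x : E n => x) μ := h.integrable (by norm_num)
  rw [lintegral_prod_symm _ hm.aemeasurable]
  rw [lintegral_congr fun q => lintegral_enorm_sub_sq_eq h (System.mean q),
    lintegral_add_left measurable_const, lintegral_const, measure_univ, mul_one,
    ← lintegral_finsetSum _ fun j _ => by fun_prop]
  congr 1
  refine lintegral_congr fun q => ?_
  rw [EuclideanSpace.real_norm_sq_eq, ENNReal.ofReal_sum_of_nonneg fun j _ => by positivity]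
  refine Finset.sum_congr rfl fun j _ => ?_
  have hj : (∫ z, z ∂μ : E n) j = ∫ z : E n, z j ∂μ :=
    ((EuclideanSpace.proj j : E n →L[ℝ] ℝ).integral_comp_comm hi).symm
  rw [PiLp.sub_apply, hj, mean_apply, ← neg_sub, neg_sq]

end MeanSquare

namespace System

variable {Ω : Type*} [MeasurableSpace Ω] {P : Measure Ω}
  {nx nu ny nξ nη : ℕ} (S : System Ω P nx nu ny nξ nη)

lemma measurable_ρ_right (y : E ny) : Measurable (S.ρ y) :=
  S.measurable_ρ.comp measurable_prodMk_left

variable {S} in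
lemma le_avgLik_iff {N : ℕ} (hN : 0 < N) {y : E ny} (hfin : ∀ x, S.ρ y x ≠ ∞) {t : ℝ≥0∞}
    (ht : t ≠ ∞) (p : Fin N → E nx) :
    t ≤ S.avgLik y p ↔ t.toReal ≤ avg (fun x => (S.ρ y x).toReal) p := by
  have hs : ∑ i, S.ρ y (p i) ≠ ∞ := ENNReal.sum_ne_top.2 fun i _ => hfin _
  have hN' : (N : ℝ≥0∞) ≠ 0 := by exact_mod_cast hN.ne'
  have h : S.avgLik y p ≠ ∞ := ENNReal.div_ne_top hs hN'
  rw [← ENNReal.toReal_le_toReal ht h, avgLik, ENNReal.toReal_div,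
    ENNReal.toReal_sum fun i _ => hfin _, avg, ENNReal.toReal_natCast, div_eq_inv_mul]

/-! ### Lower bounds for the coefficients -/

section Coefficients

variable {ε : ℕ → ℝ} {c : ℝ}

lemma ratio_nonneg [IsProbabilityMeasure P] (m : ℕ) (j : Fin nx) (k : ℕ)
    (i : Info ny nu (k + 1)) : 0 ≤ S.ratio m j k i := by
  unfold ratio; positivity

lemma le_coeff [IsProbabilityMeasure P] (hε : ∀ k, 1 ≤ k → 0 < ε k ∧ ε k < 1) (hc : 0 < c)
    (j : Fin nx) : ∀ (k : ℕ) (i : Info ny nu k),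
      1 ≤ (S.coeff ε c j k i).1 ∧ c ≤ (S.coeff ε c j k i).2
  | 0, i => by simp only [coeff]; constructor <;> linarith
  | k + 1, i => by
    obtain ⟨hM, hC⟩ := le_coeff hε hc j k i.past
    obtain ⟨he0, he1⟩ := hε (k + 1) (by omega)
    have hα : 0 ≤ S.alpha j k i := mul_nonneg (by positivity) (S.ratio_nonneg 2 j k i)
    have hβ : 0 ≤ S.beta j k i := S.ratio_nonneg 1 j k i
    have h1 : 0 < 1 - ε (k + 1) := by linarith
    have h4 : 0 < 4 - ε (k + 1) := by linarith
    have hM1 : 1 ≤ (S.coeff ε c j (k + 1) i).1 := by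
      simp only [coeff]
      have : 0 ≤ S.alpha j k i * (1 + ((4 - ε (k + 1)) / (1 - ε (k + 1)) + 1) *
        (S.coeff ε c j k i.past).1) := by positivity
      linarith
    refine ⟨hM1, ?_⟩
    simp only [coeff] at hM1 ⊢
    have h2 : (1 : ℝ) ≤ 2 ^ (3 / 2 : ℝ) := Real.one_le_rpow (by norm_num) (by norm_num)
    have hs : √c ≤ 2 ^ (3 / 2 : ℝ) * √c * √(2 + S.alpha j k i *
        (1 + ((4 - ε (k + 1)) / (1 - ε (k + 1)) + 1) * (S.coeff ε c j k i.past).1)) := by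
      have h3 := Real.one_le_sqrt.2 hM1
      calc √c = 1 * √c * 1 := by ring
        _ ≤ _ := by gcongr
    calc c = √c ^ 2 := (Real.sq_sqrt hc.le).symm
      _ ≤ _ := by
        refine pow_le_pow_left₀ (Real.sqrt_nonneg _) ?_ 2
        refine hs.trans ?_
        rw [add_assoc, add_assoc]
        refine le_add_of_nonneg_right ?_
        positivity

lemma one_le_coordNorm [IsProbabilityMeasure P] (j : Fin nx) :
    ∀ (k : ℕ) (i : Info ny nu k), 1 ≤ S.coordNorm j k i
  | 0, _ => le_max_left _ _
  | k + 1, i => (one_le_coordNorm j k i.past).trans (le_max_left _ _)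

end Coefficients

/-- The conclusion for one value of the information, from an `O(1 / N)` bound on the mean square
errors of the coordinates of the particle mean. -/
lemma mse_bounds [IsProbabilityMeasure P] {a : (N : ℕ) → ℕ → Matrix (Fin N) (Fin N) ℝ}
    {ε : ℕ → ℝ} (hε : ∀ k, 1 ≤ k → 0 < ε k ∧ ε k < 1) {k : ℕ} {i : Info ny nu k} {n₀ : ℕ}
    (hprob : ∀ N ≥ n₀, IsProbabilityMeasure (S.particleLaw (a N) k i))
    (h : MemLp (fun x : E nx => x) 2 (S.filter k i) → ∃ T : ℝ≥0∞, T ≠ ∞ ∧ ∀ N ≥ n₀, ∀ j,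
      ∫⁻ q, ENNReal.ofReal ((avg (fun x : E nx => x j) q - ∫ x : E nx, x j ∂(S.filter k i)) ^ 2)
        ∂(S.particleLaw (a N) k i) ≤ T * (N : ℝ≥0∞)⁻¹) :
    (∃ c : ℝ, 0 < c ∧ (∀ j, 0 < (S.coeff ε c j k i).2) ∧
        ∀ δ : ℝ, 0 < δ → ∀ N ≥ n₀,
          S.optMSE k i ≤ S.particleMSE (a N) k i ∧
          S.particleMSE (a N) k i ≤
            ENNReal.ofReal (1 + δ) * S.optMSE k i +
              ENNReal.ofReal (1 + 1 / δ) *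
                ((∑ j, ENNReal.ofReal (S.coeff ε c j k i).2 * S.coordNorm j k i ^ 2) / N)) ∧
      Tendsto (fun N : ℕ => S.particleMSE (a N) k i) atTop (𝓝 (S.optMSE k i)) := by
  by_cases hmem : MemLp (fun x : E nx => x) 2 (S.filter k i)
  · obtain ⟨T, hT, hb⟩ := h hmem
    have heq : ∀ N ≥ n₀, S.particleMSE (a N) k i = S.optMSE k i +
        ∑ j, ∫⁻ q, ENNReal.ofReal ((avg (fun x : E nx => x j) q -
          ∫ x : E nx, x j ∂(S.filter k i)) ^ 2) ∂(S.particleLaw (a N) k i) := fun N hN => by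
      have := hprob N hN
      exact lintegral_prod_enorm_sub_mean_sq hmem
    have hlow : ∀ N ≥ n₀, S.optMSE k i ≤ S.particleMSE (a N) k i := fun N hN => by
      rw [heq N hN]; exact le_self_add
    have hup : ∀ N ≥ n₀, S.particleMSE (a N) k i ≤
        S.optMSE k i + ∑ _j : Fin nx, T * (N : ℝ≥0∞)⁻¹ := fun N hN => by
      rw [heq N hN]
      gcongr with j
      exact hb N hN j
    -- The coefficient dominates the free constant, which may therefore be taken to be `T + 1`.
    have hc : 0 < T.toReal + 1 := by positivity
    refine ⟨⟨T.toReal + 1, hc, fun j => hc.trans_le (S.le_coeff hε hc j k i).2,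
      fun δ hδ N hN => ⟨hlow N hN, ?_⟩⟩, ?_⟩
    · refine (hup N hN).trans (add_le_add ?_ ?_)
      · refine le_mul_of_one_le_left' ?_
        rw [ENNReal.one_le_ofReal]; linarith
      · refine le_trans ?_ (le_mul_of_one_le_left' (ENNReal.one_le_ofReal.2
          (by have := one_div_pos.2 hδ; linarith)))
        rw [div_eq_mul_inv, ← Finset.sum_mul]
        gcongr with j
        calc T ≤ ENNReal.ofReal (S.coeff ε (T.toReal + 1) j k i).2 := by
              rw [← ENNReal.ofReal_toReal hT]
              refine ENNReal.ofReal_le_ofReal ?_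
              have := (S.le_coeff hε hc j k i).2
              rw [ENNReal.ofReal_toReal hT]
              linarith
          _ ≤ _ := le_mul_of_one_le_right' (one_le_pow₀ (S.one_le_coordNorm j k i))
    · have hlim : Tendsto (fun N : ℕ => S.optMSE k i + ∑ _j : Fin nx, T * (N : ℝ≥0∞)⁻¹) atTop
          (𝓝 (S.optMSE k i)) := by
        have h0 : Tendsto (fun N : ℕ => T * (N : ℝ≥0∞)⁻¹) atTop (𝓝 0) := by
          simpa using ENNReal.Tendsto.const_mul ENNReal.tendsto_inv_nat_nhds_zero (.inr hT)
        have h1 := tendsto_finsetSum (Finset.univ : Finset (Fin nx)) fun _ _ => h0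
        simpa using h1.const_add (S.optMSE k i)
      exact tendsto_of_tendsto_of_tendsto_of_le_of_le' tendsto_const_nhds hlim
        (eventually_atTop.2 ⟨n₀, hlow⟩) (eventually_atTop.2 ⟨n₀, hup⟩)
  · -- Without second moments both errors are infinite, whatever the estimate is.
    have ho : S.optMSE k i = ∞ := lintegral_enorm_sub_sq_eq_top hmem _
    have hp : ∀ N ≥ n₀, S.particleMSE (a N) k i = ∞ := fun N hN => by
      have := hprob N hN
      have hmm : Measurable (System.mean : (Fin N → E nx) → E nx) := by
        unfold System.mean; fun_prop
      have hm : Measurable fun q : E nx × (Fin N → E nx) => ‖q.1 - System.mean q.2‖ₑ ^ 2 := by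
        fun_prop
      rw [particleMSE, lintegral_prod_symm _ hm.aemeasurable]
      simp [lintegral_enorm_sub_sq_eq_top hmem]
    refine ⟨⟨1, one_pos, fun j => one_pos.trans_le (S.le_coeff hε one_pos j k i).2,
      fun δ hδ N hN => ?_⟩, ?_⟩
    · rw [hp N hN, ho, ENNReal.mul_top (by simp; linarith), top_add]
      exact ⟨le_rfl, le_rfl⟩
    · rw [ho]
      exact tendsto_const_nhds.congr' (eventually_atTop.2 ⟨n₀, fun N hN => (hp N hN).symm⟩)

end System

/-! ### Error bounds for the particle filter -/

namespace System

variable {Ω : Type*} [MeasurableSpace Ω] {P : Measure Ω}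
  {nx nu ny nξ nη : ℕ} (S : System Ω P nx nu ny nξ nη)

/-- A common bound for `ρ`, `|φ| ρ` and `φ² ρ`, for all test functions `φ` that are used. -/
def likBound (y : E ny) : ℝ := 1 + (S.supRho y).toReal + ∑ j, (S.normRho 2 j y).toReal

lemma likBound_pos (y : E ny) : 0 < S.likBound y := by unfold likBound; positivity

lemma measurable_resample {N : ℕ} (y : E ny) :
    Measurable (S.resample y : (Fin N → E nx) → _) :=
  measurable_measure_pi (ν := fun p _ => weighted (S.ρ y) p)
    fun _ => measurable_weighted (S.measurable_ρ_right y)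

lemma measurableSet_le_avgLik {N : ℕ} (y : E ny) (t : ℝ≥0∞) :
    MeasurableSet {p : Fin N → E nx | t ≤ S.avgLik y p} := by
  refine measurableSet_le measurable_const ?_
  unfold avgLik
  have := S.measurable_ρ_right y
  fun_prop

variable [IsProbabilityMeasure P]

/-- The properties of the information `i_{k+1}`, valid almost surely, on which the analysis of one
step of the particle filter rests. -/
structure Regular (k : ℕ) (i : Info ny nu (k + 1)) : Prop where
  gamma_pos : 0 < S.gammaSucc k
  gamma_le : S.gammaSucc k ≤ S.predLik k i
  supRho_lt : S.supRho i.obs < ∞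
  normRho_lt : ∀ j, S.normRho 2 j i.obs < ∞
  filter_eq : S.filter (k + 1) i = S.bayes k i
  predictor_eq : ∀ ψ : E nx → ℝ, Measurable ψ → ∀ B, (∀ x, |ψ x| ≤ B) →
    ∫ z, ψ z ∂(S.predictor k i.past) =
      ∫ x, ∫ z, ψ z ∂(S.transition x i.ctrl) ∂(S.filter k i.past)

lemma ae_regular {a : (N : ℕ) → ℕ → Matrix (Fin N) (Fin N) ℝ} {ε : ℕ → ℝ}
    {N₀ : (k : ℕ) → Info ny nu k → ℕ} (h₁ : S.LikelihoodMatching a ε N₀)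
    (h₃ : S.BoundedDensities) (k : ℕ) : ∀ᵐ i ∂(S.infoLaw (k + 1)), S.Regular k i := by
  filter_upwards [ae_essInf_le (f := S.predLik k) (μ := S.infoLaw (k + 1)), h₃ k,
    S.filter_succ_ae_eq k, S.ae_ctrl_eq k, S.ae_past (S.ae_integral_predictor k)]
    with i hγ hb hf hc hp
  refine ⟨(h₁ k).1, hγ, hb.2.1, hb.2.2, hf, fun ψ hψ B hB => ?_⟩
  rw [hp ψ hψ B hB, hc]

namespace Regular

variable {S} {k : ℕ} {i : Info ny nu (k + 1)} (h : S.Regular k i)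

include h

lemma ρ_ne_top (x : E nx) : S.ρ i.obs x ≠ ∞ :=
  ((le_iSup (fun x => S.ρ i.obs x) x).trans_lt h.supRho_lt).ne

lemma predLik_ne_top : S.predLik k i ≠ ∞ := by
  refine ((lintegral_mono fun x => le_iSup (fun x => S.ρ i.obs x) x).trans_lt ?_).ne
  simpa using! h.supRho_lt

lemma gamma_ne_top : S.gammaSucc k ≠ ∞ := (h.gamma_le.trans_lt h.predLik_ne_top.lt_top).ne

lemma half_gamma_pos : 0 < (S.gammaSucc k).toReal / 2 :=
  half_pos (ENNReal.toReal_pos h.gamma_pos.ne' h.gamma_ne_top)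

lemma toReal_ρ_le (x : E nx) : (S.ρ i.obs x).toReal ≤ (S.supRho i.obs).toReal :=
  ENNReal.toReal_mono h.supRho_lt.ne (le_iSup (fun x => S.ρ i.obs x) x)

lemma toReal_ρ_mul_sq_le (j : Fin nx) (x : E nx) :
    (S.ρ i.obs x).toReal * x j ^ 2 ≤ (S.normRho 2 j i.obs).toReal := by
  have h1 := ENNReal.toReal_mono (h.normRho_lt j).ne
    (le_iSup (fun x : E nx => ‖x j‖ₑ ^ 2 * S.ρ i.obs x) x)
  simpa [mul_comm] using h1

lemma toReal_ρ_le_bound (x : E nx) : (S.ρ i.obs x).toReal ≤ S.likBound i.obs := by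
  have h1 := h.toReal_ρ_le x
  have h2 : 0 ≤ ∑ j, (S.normRho 2 j i.obs).toReal := by positivity
  unfold likBound; linarith

lemma dominated_of_abs_le_one {φ : E nx → ℝ} (hφ : Measurable φ) (hb : ∀ x, |φ x| ≤ 1) :
    Dominated (S.ρ i.obs) (S.likBound i.obs) φ := by
  refine ⟨hφ, fun x => ?_, fun x => ?_⟩ <;> refine le_trans ?_ (h.toReal_ρ_le_bound x)
  · rw [abs_mul, abs_of_nonneg ENNReal.toReal_nonneg]
    exact mul_le_of_le_one_right ENNReal.toReal_nonneg (hb x)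
  · refine mul_le_of_le_one_right ENNReal.toReal_nonneg ?_
    rw [← sq_abs]
    exact pow_le_one₀ (abs_nonneg _) (hb x)

lemma dominated_coord (j : Fin nx) :
    Dominated (S.ρ i.obs) (S.likBound i.obs) fun x : E nx => x j := by
  have hj : (S.normRho 2 j i.obs).toReal ≤ ∑ j, (S.normRho 2 j i.obs).toReal :=
    Finset.single_le_sum (f := fun j => (S.normRho 2 j i.obs).toReal)
      (fun _ _ => ENNReal.toReal_nonneg) (Finset.mem_univ j)
  have hs : 0 ≤ (S.supRho i.obs).toReal := ENNReal.toReal_nonneg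
  refine ⟨by fun_prop, fun x => ?_, fun x => ?_⟩
  · have h1 := h.toReal_ρ_le x
    have h2 := h.toReal_ρ_mul_sq_le j x
    have h0 : 0 ≤ (S.ρ i.obs x).toReal := ENNReal.toReal_nonneg
    rw [abs_mul, abs_of_nonneg h0]
    have h3 : |x j| ≤ 1 + x j ^ 2 := by
      rw [← sq_abs]; nlinarith [sq_nonneg (|x j| - 1), abs_nonneg (x j)]
    unfold likBound
    nlinarith [mul_le_mul_of_nonneg_left h3 h0]
  · have h2 := h.toReal_ρ_mul_sq_le j x
    unfold likBound; linarith

lemma integral_ρ : ∫ x, (S.ρ i.obs x).toReal ∂(S.predictor k i.past) = (S.predLik k i).toReal :=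
  integral_toReal (S.measurable_ρ_right _).aemeasurable
    (ae_of_all _ fun x => (h.ρ_ne_top x).lt_top)

lemma two_mul_half_gamma_le : 2 * ((S.gammaSucc k).toReal / 2) ≤
    ∫ x, (S.ρ i.obs x).toReal ∂(S.predictor k i.past) := by
  rw [h.integral_ρ, mul_div_cancel₀ _ two_ne_zero]
  exact ENNReal.toReal_mono h.predLik_ne_top h.gamma_le

lemma predLik_inv_ne_top : (S.predLik k i)⁻¹ ≠ ∞ :=
  ENNReal.inv_ne_top.2 (h.gamma_pos.trans_le h.gamma_le).ne'

lemma integral_filter (φ : E nx → ℝ) :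
    ∫ x, φ x ∂(S.filter (k + 1) i) =
      (∫ x, (S.ρ i.obs x).toReal * φ x ∂(S.predictor k i.past)) /
        ∫ x, (S.ρ i.obs x).toReal ∂(S.predictor k i.past) := by
  rw [h.filter_eq, bayes_apply, integral_withDensity_eq_integral_toReal_smul
    ((S.measurable_ρ_right _).mul_const _)
    (ae_of_all _ fun x => ENNReal.mul_lt_top (h.ρ_ne_top x).lt_top h.predLik_inv_ne_top.lt_top),
    h.integral_ρ, div_eq_inv_mul, ← integral_const_mul]
  congr 1 with x
  rw [ENNReal.toReal_mul, ENNReal.toReal_inv, smul_eq_mul]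
  ring

lemma accept_eq {N : ℕ} (hN : 0 < N) :
    {p : Fin N → E nx | S.gammaSucc k / 2 ≤ S.avgLik i.obs p} =
      {p | (S.gammaSucc k).toReal / 2 ≤ avg (fun x => (S.ρ i.obs x).toReal) p} := by
  ext p
  have := le_avgLik_iff hN h.ρ_ne_top (ENNReal.div_ne_top h.gamma_ne_top two_ne_zero) p
  simpa using! this

end Regular

/-- The particles before normalisation; the total mass is the probability that all selection steps
terminate. -/
def rawLaw {N : ℕ} (a : ℕ → Matrix (Fin N) (Fin N) ℝ) (k : ℕ) (i : Info ny nu (k + 1)) :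
    Measure (Fin N → E nx) :=
  (S.particleLaw a k i.past).bind fun x =>
    (S.select (a k) i.ctrl i.obs (S.gammaSucc k / 2) x).bind (S.resample i.obs)

lemma particleLaw_succ {N : ℕ} (a : ℕ → Matrix (Fin N) (Fin N) ℝ) (k : ℕ)
    (i : Info ny nu (k + 1)) :
    S.particleLaw a (k + 1) i = (S.rawLaw a k i Set.univ)⁻¹ • S.rawLaw a k i := rfl

lemma particleLaw_univ_le {N : ℕ} (a : ℕ → Matrix (Fin N) (Fin N) ℝ) (k : ℕ)
    (i : Info ny nu k) : S.particleLaw a k i Set.univ ≤ 1 := by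
  cases k with
  | zero =>
    change Measure.pi (fun _ => S.filter 0 i) Set.univ ≤ 1
    exact prob_le_one
  | succ k =>
    rw [particleLaw_succ, Measure.smul_apply, smul_eq_mul]
    exact ENNReal.inv_mul_le_one _

lemma measurable_propose {N : ℕ} {a : Matrix (Fin N) (Fin N) ℝ} (u : E nu) :
    Measurable (S.propose a u : (Fin N → E nx) → _) :=
  measurable_measure_pi (ν := fun x : Fin N → E nx => mixture a (fun x => S.transition x u) x)
    fun l => measurable_mixture (S.measurable_transition_left u) l

lemma measurable_select {N : ℕ} {a : Matrix (Fin N) (Fin N) ℝ} (u : E nu) (y : E ny) (t : ℝ≥0∞) :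
    Measurable (S.select a u y t : (Fin N → E nx) → _) :=
  (measurable_cond (S.measurableSet_le_avgLik y t)).comp (S.measurable_propose u)

section Selection

variable {S} {N k : ℕ} {a : ℕ → Matrix (Fin N) (Fin N) ℝ} {i : Info ny nu (k + 1)}
  (h : S.Regular k i)

include h

lemma Regular.resample_univ {p : Fin N → E nx}
    (hp : S.gammaSucc k / 2 ≤ S.avgLik i.obs p) : S.resample i.obs p Set.univ = 1 := by
  have hne : ∑ l, S.ρ i.obs (p l) ≠ 0 := by
    intro h0
    rw [avgLik, h0, ENNReal.zero_div, nonpos_iff_eq_zero, ENNReal.div_eq_zero_iff] at hp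
    exact hp.elim h.gamma_pos.ne' (by simp)
  have := isProbabilityMeasure_weighted hne (ENNReal.sum_ne_top.2 fun l _ => h.ρ_ne_top (p l))
  change Measure.pi (fun _ => weighted (S.ρ i.obs) p) Set.univ = 1
  exact measure_univ

lemma Regular.lintegral_resample_univ (x : Fin N → E nx) :
    ((S.select (a k) i.ctrl i.obs (S.gammaSucc k / 2) x).bind (S.resample i.obs)) Set.univ =
      S.select (a k) i.ctrl i.obs (S.gammaSucc k / 2) x Set.univ := by
  rw [Measure.bind_apply MeasurableSet.univ (S.measurable_resample _).aemeasurable,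
    ← setLIntegral_one, Measure.restrict_univ]
  refine lintegral_congr_ae ?_
  filter_upwards [ae_cond_mem (μ := S.propose (a k) i.ctrl x)
    (S.measurableSet_le_avgLik i.obs (S.gammaSucc k / 2))] with p hp
  exact h.resample_univ hp

lemma Regular.rawLaw_univ : S.rawLaw a k i Set.univ =
    ∫⁻ x, S.select (a k) i.ctrl i.obs (S.gammaSucc k / 2) x Set.univ
      ∂(S.particleLaw a k i.past) := by
  have hm : Measurable fun x : Fin N → E nx =>
      (S.select (a k) i.ctrl i.obs (S.gammaSucc k / 2) x).bind (S.resample i.obs) :=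
    (Measure.measurable_bind' (S.measurable_resample _)).comp (S.measurable_select _ _ _)
  rw [rawLaw, Measure.bind_apply MeasurableSet.univ hm.aemeasurable]
  exact lintegral_congr fun x => h.lintegral_resample_univ x

lemma Regular.rawLaw_univ_le : S.rawLaw a k i Set.univ ≤ 1 := by
  rw [h.rawLaw_univ]
  calc _ ≤ ∫⁻ _x, 1 ∂(S.particleLaw a k i.past) := by
        refine lintegral_mono fun x => ?_
        rw [select, ProbabilityTheory.cond, Measure.smul_apply, Measure.restrict_apply_univ,
          smul_eq_mul]
        exact ENNReal.inv_mul_le_one _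
    _ ≤ 1 := by simpa using S.particleLaw_univ_le a k i.past

/-- The selection terminates at least with the probability that the first draw is accepted. -/
lemma Regular.predictedLaw_le_rawLaw_univ (ha : a k ∈ doublyStochastic ℝ (Fin N)) :
    S.predictedLaw a k i {p | S.gammaSucc k < S.avgLik i.obs p} ≤ S.rawLaw a k i Set.univ := by
  have hA := S.measurableSet_le_avgLik (N := N) i.obs (S.gammaSucc k / 2)
  calc _ ≤ S.predictedLaw a k i {p | S.gammaSucc k / 2 ≤ S.avgLik i.obs p} := by
        refine measure_mono fun p hp => ?_
        exact ENNReal.half_le_self.trans (le_of_lt hp)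
    _ = ∫⁻ x, S.propose (a k) i.ctrl x {p | S.gammaSucc k / 2 ≤ S.avgLik i.obs p}
        ∂(S.particleLaw a k i.past) := by
        rw [predictedLaw, Measure.bind_apply hA (S.measurable_propose _).aemeasurable]
    _ ≤ _ := by
        rw [h.rawLaw_univ]
        refine lintegral_mono fun x => ?_
        have hmix := isProbabilityMeasure_mixture (τ := fun x => S.transition x i.ctrl) ha x
        have hpr : IsProbabilityMeasure (S.propose (a k) i.ctrl x) :=

          inferInstanceAs (IsProbabilityMeasure (Measure.pi
            (mixture (a k) (fun x => S.transition x i.ctrl) x)))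
        by_cases h0 : S.propose (a k) i.ctrl x {p | S.gammaSucc k / 2 ≤ S.avgLik i.obs p} = 0
        · simp [h0]
        · have := cond_isProbabilityMeasure h0
          rw [select, measure_univ]
          exact prob_le_one

variable {e : ℝ}

lemma Regular.isProbabilityMeasure_particleLaw (he : 0 < 1 - e)
    (ha : a k ∈ doublyStochastic ℝ (Fin N))
    (hL : ENNReal.ofReal (1 - e) ≤
      S.predictedLaw a k i {p | S.gammaSucc k < S.avgLik i.obs p}) :
    IsProbabilityMeasure (S.particleLaw a (k + 1) i) := by
  refine ⟨?_⟩
  rw [particleLaw_succ, Measure.smul_apply, smul_eq_mul]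
  refine ENNReal.inv_mul_cancel ?_ ((h.rawLaw_univ_le).trans_lt ENNReal.one_lt_top).ne
  exact ((ENNReal.ofReal_pos.2 he).trans_le
    (hL.trans (h.predictedLaw_le_rawLaw_univ ha))).ne'

lemma Regular.lintegral_particleLaw_le (hN : 0 < N) (ha : a k ∈ doublyStochastic ℝ (Fin N))
    (hL : ENNReal.ofReal (1 - e) ≤
      S.predictedLaw a k i {p | S.gammaSucc k < S.avgLik i.obs p})
    (F : (Fin N → E nx) → ℝ≥0∞) :
    ∫⁻ q, F q ∂(S.particleLaw a (k + 1) i) ≤ (ENNReal.ofReal (1 - e))⁻¹ *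
      ∫⁻ x, ∫⁻ p, ∫⁻ q, F q ∂(Measure.pi fun _ : Fin N => weighted (S.ρ i.obs) p)
        ∂((Measure.pi (mixture (a k) (fun x => S.transition x i.ctrl) x))[|{p |
          (S.gammaSucc k).toReal / 2 ≤ avg (fun x => (S.ρ i.obs x).toReal) p}])
        ∂(S.particleLaw a k i.past) := by
  rw [particleLaw_succ, lintegral_smul_measure, smul_eq_mul, ← h.accept_eq hN]
  refine mul_le_mul' (ENNReal.inv_le_inv.2 (hL.trans (h.predictedLaw_le_rawLaw_univ ha))) ?_
  refine (Measure.lintegral_bind_le _ _ _).trans (lintegral_mono fun x => ?_)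
  exact Measure.lintegral_bind_le _ _ _

/-- The mean square error for dominated functions is bounded, without any information on the
particles at the preceding step. -/
lemma Regular.lintegral_error_le_crude (hN : 0 < N) (ha : a k ∈ doublyStochastic ℝ (Fin N))
    (hL : ENNReal.ofReal (1 - e) ≤
      S.predictedLaw a k i {p | S.gammaSucc k < S.avgLik i.obs p})
    {φ : E nx → ℝ} (hφ : Dominated (S.ρ i.obs) (S.likBound i.obs) φ) :
    ∫⁻ q, ENNReal.ofReal ((avg φ q - ∫ x, φ x ∂(S.filter (k + 1) i)) ^ 2)
        ∂(S.particleLaw a (k + 1) i) ≤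
      (ENNReal.ofReal (1 - e))⁻¹ *
        crudeConst (S.likBound i.obs) ((S.gammaSucc k).toReal / 2) := by
  refine (h.lintegral_particleLaw_le hN ha hL _).trans ?_
  gcongr
  rw [h.integral_filter]
  have hA : MeasurableSet {p : Fin N → E nx |
      (S.gammaSucc k).toReal / 2 ≤ avg (fun x => (S.ρ i.obs x).toReal) p} :=
    h.accept_eq hN ▸ S.measurableSet_le_avgLik _ _
  set C := crudeConst (S.likBound i.obs) ((S.gammaSucc k).toReal / 2)
  calc _ ≤ ∫⁻ _x, C ∂(S.particleLaw a k i.past) := by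
        refine lintegral_mono fun x => ?_
        refine (lintegral_mono_ae (g := fun _ => C) ?_).trans ?_
        · filter_upwards [ae_cond_mem hA] with p hp
          exact hφ.resample_le_crude hN h.ρ_ne_top h.half_gamma_pos h.two_mul_half_gamma_le
            (abs_integral_le_of_abs_le hφ.abs_le) hp
        · rw [lintegral_const, ProbabilityTheory.cond, Measure.smul_apply,
            Measure.restrict_apply_univ, smul_eq_mul]
          exact mul_le_of_le_one_right' (ENNReal.inv_mul_le_one _)
    _ ≤ C := by
        rw [lintegral_const]
        exact mul_le_of_le_one_right' (S.particleLaw_univ_le a k i.past)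

/-- The mean square error for dominated functions is of order `1 / N` if the one for bounded
functions at the preceding step is. -/
lemma Regular.lintegral_error_le (hN : 0 < N) (ha : a k ∈ doublyStochastic ℝ (Fin N))
    (hL : ENNReal.ofReal (1 - e) ≤
      S.predictedLaw a k i {p | S.gammaSucc k < S.avgLik i.obs p}) {D : ℝ≥0∞}
    (hD : MeanSquareApprox (S.particleLaw a k i.past) (S.filter k i.past) D)
    {φ : E nx → ℝ} (hφ : Dominated (S.ρ i.obs) (S.likBound i.obs) φ) :
    ∫⁻ q, ENNReal.ofReal ((avg φ q - ∫ x, φ x ∂(S.filter (k + 1) i)) ^ 2)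
        ∂(S.particleLaw a (k + 1) i) ≤
      (ENNReal.ofReal (1 - e))⁻¹ *
        stepConst (S.likBound i.obs) ((S.gammaSucc k).toReal / 2) D * (N : ℝ≥0∞)⁻¹ := by
  refine (h.lintegral_particleLaw_le hN ha hL _).trans ?_
  rw [h.integral_filter, mul_assoc]
  gcongr
  exact hφ.lintegral_step_le hN (S.measurable_ρ_right _) h.ρ_ne_top h.toReal_ρ_le_bound
    (S.likBound_pos _) h.half_gamma_pos hD (S.particleLaw_univ_le a k i.past) ha
    (S.measurable_transition_left _)
    (fun ψ hψ hb => h.predictor_eq ψ hψ _ hb) h.two_mul_half_gamma_le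

end Selection

section Induction

variable {a : (N : ℕ) → ℕ → Matrix (Fin N) (Fin N) ℝ} {ε : ℕ → ℝ}
  {N₀ : (k : ℕ) → Info ny nu k → ℕ}

lemma meanSquareApprox_zero (i : Info ny nu 0) {N : ℕ} (hN : 0 < N) :
    MeanSquareApprox (S.particleLaw (a N) 0 i) (S.filter 0 i) 1 := by
  intro φ hφ hb
  have h1 := lintegral_avg_sub_mean_sq_le hN (fun _ => S.filter 0 i) (φ := φ) (B := 1)
    (fun _ => MemLp.of_bound hφ.aestronglyMeasurable 1 (ae_of_all _ hb)) (fun _ => by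
      refine (le_abs_self _).trans (abs_integral_le_of_abs_le fun x => ?_)
      rw [abs_pow]
      exact pow_le_one₀ (abs_nonneg _) (hb x))
  rw [inv_natCast_mul_sum_const hN, ENNReal.ofReal_one] at h1
  exact h1

/-- For almost every value of the information, the particles approximate the filter at the rate
`1 / N` on bounded functions, as soon as their number is large enough for all steps. -/
lemma ae_meanSquareApprox (ha : ∀ N k, a N k ∈ doublyStochastic ℝ (Fin N))
    (hε : ∀ k, 1 ≤ k → 0 < ε k ∧ ε k < 1) (h₁ : S.LikelihoodMatching a ε N₀)
    (h₃ : S.BoundedDensities) (k : ℕ) :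
    ∀ᵐ i ∂(S.infoLaw k), ∃ (n : ℕ) (D : ℝ≥0∞), D ≠ ∞ ∧ ∀ N ≥ n, 0 < N →
      MeanSquareApprox (S.particleLaw (a N) k i) (S.filter k i) D := by
  induction k with
  | zero =>
    exact ae_of_all _ fun i => ⟨0, 1, by simp, fun N _ hN => S.meanSquareApprox_zero i hN⟩
  | succ k ih =>
    filter_upwards [S.ae_past ih, S.ae_regular h₁ h₃ k, (h₁ k).2] with i hi hreg hL
    obtain ⟨n, D, hD, hn⟩ := hi
    have he : 0 < 1 - ε (k + 1) := by linarith [(hε (k + 1) (by omega)).2]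
    refine ⟨max n (N₀ (k + 1) i), (ENNReal.ofReal (1 - ε (k + 1)))⁻¹ *
      stepConst (S.likBound i.obs) ((S.gammaSucc k).toReal / 2) D,
      ENNReal.mul_ne_top (ENNReal.inv_ne_top.2 (ENNReal.ofReal_pos.2 he).ne')
        (stepConst_ne_top hD), fun N hN hN0 φ hφ hb => ?_⟩
    exact hreg.lintegral_error_le hN0 (ha N k) (hL N ((le_max_right _ _).trans hN))
      (hn N ((le_max_left _ _).trans hN) hN0) (hreg.dominated_of_abs_le_one hφ hb)

end Induction

end System

end ParticleMSE

end

theorem mainTheorem2 {Ω : Type*} [MeasurableSpace Ω] (P : Measure Ω) [IsProbabilityMeasure P]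
    {nx nu ny nξ nη : ℕ} (S : ParticleMSE.System Ω P nx nu ny nξ nη)
    (a : (N : ℕ) → ℕ → Matrix (Fin N) (Fin N) ℝ)
    (ha : ∀ N k, a N k ∈ doublyStochastic ℝ (Fin N))
    (ε : ℕ → ℝ) (hε : ∀ k, 1 ≤ k → 0 < ε k ∧ ε k < 1)
    (N₀ : (k : ℕ) → ParticleMSE.Info ny nu k → ℕ) (hN₀ : ∀ k i, 0 < N₀ k i)
    (h₁ : S.LikelihoodMatching a ε N₀)
    (h₂ : S.FiniteDensities)
    (h₃ : S.BoundedDensities)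
    (k : ℕ) :
    ∀ᵐ i ∂(S.infoLaw k),
      (∃ c : ℝ, 0 < c ∧ (∀ j, 0 < (S.coeff ε c j k i).2) ∧
        ∀ δ : ℝ, 0 < δ → ∀ N ≥ N₀ k i,
          S.optMSE k i ≤ S.particleMSE (a N) k i ∧
          S.particleMSE (a N) k i ≤
            ENNReal.ofReal (1 + δ) * S.optMSE k i +
              ENNReal.ofReal (1 + 1 / δ) *
                ((∑ j, ENNReal.ofReal (S.coeff ε c j k i).2 * S.coordNorm j k i ^ 2) / N)) ∧
      Tendsto (fun N : ℕ => S.particleMSE (a N) k i) atTop (𝓝 (S.optMSE k i)) := by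
  cases k with
  | zero =>
    refine ae_of_all _ fun i => S.mse_bounds hε (fun N _ => ?_) fun hmem => ?_
    · exact inferInstanceAs (IsProbabilityMeasure (Measure.pi fun _ : Fin N => S.filter 0 i))
    · refine ⟨∑ j, ENNReal.ofReal (∫ x : ParticleMSE.E nx, x j ^ 2 ∂(S.filter 0 i)),
        ENNReal.sum_ne_top.2 fun _ _ => ENNReal.ofReal_ne_top, fun N hN j => ?_⟩
      have hN0 : 0 < N := (hN₀ 0 i).trans_le hN
      have h := ParticleMSE.lintegral_avg_sub_mean_sq_le hN0 (fun _ => S.filter 0 i)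
        (fun _ => hmem.eval_piLp j) (fun _ => le_rfl)
      rw [ParticleMSE.inv_natCast_mul_sum_const hN0] at h
      refine h.trans (mul_le_mul' ?_ le_rfl)
      exact Finset.single_le_sum (f := fun j => ENNReal.ofReal
        (∫ x : ParticleMSE.E nx, x j ^ 2 ∂(S.filter 0 i))) (fun _ _ => zero_le) (Finset.mem_univ j)
  | succ k =>
    filter_upwards [S.ae_past (S.ae_meanSquareApprox ha hε h₁ h₃ k), S.ae_regular h₁ h₃ k,
      (h₁ k).2] with i hi hreg hL
    obtain ⟨n, D, hD, hn⟩ := hi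
    have he : 0 < 1 - ε (k + 1) := by linarith [(hε (k + 1) (by omega)).2]
    have hpos : ∀ N ≥ N₀ (k + 1) i, 0 < N := fun N hN => (hN₀ (k + 1) i).trans_le hN
    refine S.mse_bounds hε (fun N hN => hreg.isProbabilityMeasure_particleLaw he (ha N k)
      (hL N hN)) fun _ => ?_
    -- For the finitely many `N` between `N₀` and `n` the error is merely bounded, and
    -- `1 ≤ n * N⁻¹` turns this into the required form.
    refine ⟨(ENNReal.ofReal (1 - ε (k + 1)))⁻¹ *
      ParticleMSE.stepConst (S.likBound i.obs) ((S.gammaSucc k).toReal / 2) D +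
      (ENNReal.ofReal (1 - ε (k + 1)))⁻¹ *
      ParticleMSE.crudeConst (S.likBound i.obs) ((S.gammaSucc k).toReal / 2) * n, ?_,
      fun N hN j => ?_⟩
    · have h1 := ENNReal.inv_ne_top.2 (ENNReal.ofReal_pos.2 he).ne'
      have h2 := ParticleMSE.stepConst_ne_top (B := S.likBound i.obs)
        (g := (S.gammaSucc k).toReal / 2) hD
      have h3 := ParticleMSE.crudeConst_ne_top (B := S.likBound i.obs)
        (g := (S.gammaSucc k).toReal / 2)
      finiteness
    · have hN0 := hpos N hN
      by_cases hnN : n ≤ N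
      · refine (hreg.lintegral_error_le hN0 (ha N k) (hL N hN) (hn N hnN hN0)
          (hreg.dominated_coord j)).trans ?_
        gcongr
        exact le_self_add
      · refine (hreg.lintegral_error_le_crude hN0 (ha N k) (hL N hN)
          (hreg.dominated_coord j)).trans ?_
        rw [add_mul]
        refine le_add_left ?_
        rw [mul_assoc _ (n : ℝ≥0∞)]
        refine le_mul_of_one_le_right' ?_
        rw [← div_eq_mul_inv, ENNReal.le_div_iff_mul_le (.inl (by exact_mod_cast hN0.ne'))
          (.inl (by simp)), one_mul]
        exact_mod_cast (not_le.1 hnN).le
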